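/- Let $0<n^\star<n$, let $f,g:\mathbb R^n\to\mathbb R^n$ be smooth ($C^\infty$) vector fields, and let $h:\mathbb R^n\to\mathbb R^p$ be smooth with $\operatorname{rank} \mathrm dh_x=p$ for all $x\in\mathbb R^n$. Consider the control system $\dot x=f(x)+g(x)u$, $u\in\mathbb R$, with output $y=h(x)$. Let $\Gamma^\star\subset\mathbb R^n$ be a closed, connected, embedded smooth submanifold of dimension $n^\star$ which is controlled invariant, i.e. there is a smooth feedback $\bar u:\Gamma^\star\to\mathbb R$ that makes $\Gamma^\star$ invariant for the closed-loop system $\dot x=f(x)+g(x)\bar u(x)$. Let $x_0\in\Gamma^\star$. Write $L_v\mu(x)=\mathrm d\mu_x(v(x))$ for the Lie derivative. We say that *LTFLPI (local transverse feedback linearization with partial information) is solvable at $x_0$* if there are an open neighbourhood $U$ of $x_0$ and a diffeomorphism $\Xi:U\to\Xi(U)$, $x\mapsto(\eta,\xi)$, onto an open subset $\Xi(U)$ of $(\Gamma^\star\cap U)\times\mathbb R^{n-n^\star}$ such that (i) $\xi=0$ on $\Gamma^\star\cap U$; (ii) in the coordinates $(\eta,\xi)$ the system reads $\dot\eta=f_0(\eta,\xi)$,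 $\dot\xi=A\xi+b\,(a_1(\eta,\xi)+a_2(\eta,\xi)u)$ with smooth $f_0,a_1,a_2$ on $\Xi(U)$, where $(A,b)$ is in Brunovský normal form with one chain of $n-n^\star$ integrators (that is, $(A\xi)_i=\xi_{i+1}$ for $i<n-n^\star$, $(A\xi)_{n-n^\star}=0$, and $b$ is the last standard basis vector) and $a_2\neq0$ on $\Xi(U)$; (iii) the first component of $\xi$ is observable: there is a function $\tilde\lambda:h(U)\to\mathbb R$ with $\xi_1=\tilde\lambda\circ h$ on $U$. **Theorem.** LTFLPI is solvable at $x_0$ if and only if there is a smooth real-valued function $\tilde\lambda$, defined on an open neighbourhood $W$ of $h(x_0)$ in $\mathbb R^p$, such that (a) for some open neighbourhood $U$ of $x_0$ with $h(U)\subseteq W$, $\Gamma^\star\cap U\subseteq\{x\in U:\tilde\lambda(h(x))=0\}$; and (b) the system $\dot x=f(x)+g(x)u$ with virtual output $\lambda=\tilde\lambda\circ h$ has relative degree $r=n-n^\star$ at $x_0$, i.e. $L_gL_f^k\lambda=0$ in a neighbourhood of $x_0$ for $0\le k<r-1$, and $L_gL_f^{r-1}\lambda(x_0)\neq0$. Moreover,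 for every $\tilde\lambda$ and $U$ satisfying (a) and (b) there are an open neighbourhood $V\subseteq U$ of $x_0$ and a connected component $\mathcal Z^\star$ of the zero dynamics manifold $\{x\in U:\lambda(x)=L_f\lambda(x)=\dots=L_f^{r-1}\lambda(x)=0\}$ of the system with output $\lambda$ such that $\mathcal Z^\star\cap V=\Gamma^\star\cap V$. -/

import Mathlib

open Set Filter Topology
open scoped ContDiff

noncomputable section

/-- The Euclidean space `ℝᵏ`. -/
abbrev Eu (k : ℕ) : Type := EuclideanSpace ℝ (Fin k)

/-- `N` is an embedded smooth `d`-dimensional submanifold of `ℝⁿ` (without boundary): around each of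
its points there is a smooth chart of `ℝⁿ` in which `N` is the slice `ℝᵈ × {0}`. -/
def IsEmbeddedSubmanifold {n : ℕ} (d : ℕ) (N : Set (Eu n)) : Prop :=
  ∀ x ∈ N, ∃ φ : OpenPartialHomeomorph (Eu n) (Eu d × Eu (n - d)),
    x ∈ φ.source ∧ ContDiffOn ℝ ∞ φ φ.source ∧ ContDiffOn ℝ ∞ φ.symm φ.target ∧
      φ '' (N ∩ φ.source) = φ.target ∩ {z | z.2 = 0}

/-- `N` is (forward) invariant under the vector field `v`: every integral curve of `v` that starts
in `N` at time `0` stays in `N` for as long as it exists. -/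
def IsInvariantUnder {n : ℕ} (v : Eu n → Eu n) (N : Set (Eu n)) : Prop :=
  ∀ (T : ℝ) (γ : ℝ → Eu n), γ 0 ∈ N → IsIntegralCurveOn γ (fun _ => v) (Ico 0 T) →
    ∀ t ∈ Ico 0 T, γ t ∈ N

/-- `N` is controlled invariant for `ẋ = f(x) + g(x)u`: there is a smooth feedback `u : N → ℝ` that
makes `N` invariant. The closed-loop vector field is only prescribed on `N`; invariance is that of
a smooth vector field on `ℝⁿ` which restricts to it. (Only the values of `u` on `N` matter, and
on an embedded submanifold `ContDiffOn` is smoothness in the sense of the manifold `N`.) -/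
def IsControlledInvariant {n : ℕ} (f g : Eu n → Eu n) (N : Set (Eu n)) : Prop :=
  ∃ u : Eu n → ℝ, ContDiffOn ℝ ∞ u N ∧
    ∃ v : Eu n → Eu n, ContDiff ℝ ∞ v ∧ (∀ x ∈ N, v x = f x + u x • g x) ∧ IsInvariantUnder v N

/-- The Lie derivative `L_v μ` of a real-valued function along a vector field. -/
def lieD {n : ℕ} (v : Eu n → Eu n) (μ : Eu n → ℝ) : Eu n → ℝ :=
  fun x => fderiv ℝ μ x (v x)

/-- The system `ẋ = f(x) + g(x)u`, `y' = μ(x)` has relative degree `r` at `x₀`: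
`L_g L_f^k μ` vanishes near `x₀` for `k < r - 1`, and `L_g L_f^(r-1) μ (x₀) ≠ 0`. -/
def HasRelativeDegreeAt {n : ℕ} (f g : Eu n → Eu n) (μ : Eu n → ℝ) (r : ℕ) (x₀ : Eu n) : Prop :=
  1 ≤ r ∧ (∀ k, k + 1 < r → ∀ᶠ x in 𝓝 x₀, lieD g ((lieD f)^[k] μ) x = 0) ∧
    lieD g ((lieD f)^[r - 1] μ) x₀ ≠ 0

/-- The zero dynamics manifold, in the domain `D`, of the system `ẋ = f(x) + g(x)u`, `y' = μ(x)` of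
relative degree `r`: the set where `μ, L_f μ, …, L_f^(r-1) μ` all vanish. -/
def zeroDynamicsManifold {n : ℕ} (f : Eu n → Eu n) (μ : Eu n → ℝ) (r : ℕ) (D : Set (Eu n)) :
    Set (Eu n) :=
  {x ∈ D | ∀ k < r, (lieD f)^[k] μ x = 0}

/-- The matrix `A` of the Brunovský normal form with one chain of `r` integrators. -/
def brunovskyA (r : ℕ) : Matrix (Fin r) (Fin r) ℝ :=
  Matrix.of fun i j => if (i : ℕ) + 1 = j then 1 else 0

/-- The vector `b` of the Brunovský normal form with one chain of `r` integrators. -/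
def brunovskyB (r : ℕ) : Fin r → ℝ :=
  fun i => if (i : ℕ) + 1 = r then 1 else 0

/-- `Ξ` is a smooth diffeomorphism of the open set `U ⊆ ℝⁿ` onto a (relatively) open subset of
the manifold `(N ∩ U) × ℝʳ`, which is regarded as a subset of `ℝⁿ × ℝʳ`. -/
def IsDiffeoIntoProduct {n r : ℕ} (N U : Set (Eu n)) (Ξ : Eu n → Eu n × Eu r) : Prop :=
  (∀ x ∈ U, (Ξ x).1 ∈ N ∩ U) ∧
  (∃ O : Set (Eu n × Eu r), IsOpen O ∧ Ξ '' U = O ∩ (N ∩ U) ×ˢ univ) ∧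
  ContDiffOn ℝ ∞ Ξ U ∧
  ∃ Ψ : Eu n × Eu r → Eu n, ContDiffOn ℝ ∞ Ψ (Ξ '' U) ∧ ∀ x ∈ U, Ψ (Ξ x) = x

/-- Local transverse feedback linearization with partial information is solvable at `x₀`, for the
system `ẋ = f(x) + g(x)u` with output `y = h(x)` and the `nstar`-dimensional target set `Γ`. Here
`Ξ x = (η, ξ)`, and the dynamics in the coordinates `(η, ξ)` is the image of the vector field
`f + g u` under the derivative of `Ξ`, for every value `u` of the input. -/
def LTFLPISolvable {n p : ℕ} (nstar : ℕ) (hlt : nstar < n) (f g : Eu n → Eu n) (h : Eu n → Eu p)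
    (Γ : Set (Eu n)) (x₀ : Eu n) : Prop :=
  ∃ (U : Set (Eu n)) (Ξ : Eu n → Eu n × Eu (n - nstar)),
    IsOpen U ∧ x₀ ∈ U ∧ IsDiffeoIntoProduct Γ U Ξ ∧
    -- (i)
    (∀ x ∈ Γ ∩ U, (Ξ x).2 = 0) ∧
    -- (ii)
    (∃ (f₀ : Eu n × Eu (n - nstar) → Eu n) (a₁ a₂ : Eu n × Eu (n - nstar) → ℝ),
      ContDiffOn ℝ ∞ f₀ (Ξ '' U) ∧ ContDiffOn ℝ ∞ a₁ (Ξ '' U) ∧ ContDiffOn ℝ ∞ a₂ (Ξ '' U) ∧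
      (∀ z ∈ Ξ '' U, a₂ z ≠ 0) ∧
      ∀ x ∈ U, ∀ u : ℝ,
        fderiv ℝ Ξ x (f x + u • g x) =
          (f₀ (Ξ x),
            WithLp.toLp 2 ((brunovskyA (n - nstar)).mulVec (Ξ x).2.ofLp +
              (a₁ (Ξ x) + a₂ (Ξ x) * u) • brunovskyB (n - nstar)))) ∧
    -- (iii)
    ∃ lam : Eu p → ℝ, ∀ x ∈ U, (Ξ x).2 ⟨0, Nat.sub_pos_of_lt hlt⟩ = lam (h x)

/-- `lam`, a smooth function on the open neighbourhood `W` of `h(x₀)`, satisfies the two conditions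
of the theorem: (a) `Γ ∩ U` is contained in the zero set of `lam ∘ h` on the open neighbourhood `U`
of `x₀`; (b) the virtual output `lam ∘ h` has relative degree `n - nstar` at `x₀`. -/
def IsObservableTransverseOutput {n p : ℕ} (nstar : ℕ) (f g : Eu n → Eu n) (h : Eu n → Eu p)
    (Γ : Set (Eu n)) (x₀ : Eu n) (lam : Eu p → ℝ) (W : Set (Eu p)) (U : Set (Eu n)) : Prop :=
  (IsOpen W ∧ h x₀ ∈ W ∧ ContDiffOn ℝ ∞ lam W) ∧
  (IsOpen U ∧ x₀ ∈ U ∧ MapsTo h U W ∧ Γ ∩ U ⊆ {x ∈ U | lam (h x) = 0}) ∧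
  HasRelativeDegreeAt f g (lam ∘ h) (n - nstar) x₀

end

-- Let `r = n - nstar`. Given a transverse output `λ`, put `ξ = (λ, L_f λ, …, L_f^(r-1) λ)`. Paired
-- with the brackets `ad_f^j g`, the differentials of its entries form a triangular matrix with
-- `±L_g L_f^(r-1) λ` on the diagonal, so `ξ` is a submersion at `x₀`
-- (`surjective_fderiv_lieChain`). Along closed-loop trajectories in `Γ` the input does not affect
-- `L_f^k λ` to first order for `k + 1 < r`, hence `ξ = 0` on `Γ`
-- (`IsControlledInvariant.iterate_lieD_eq_zero`). Both sets have dimension `nstar`, so `Γ = {ξ =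
-- 0}` near `x₀` (`IsEmbeddedSubmanifold.eventually_mem_iff`). This is the zero dynamics manifold;
-- in a box-shaped chart its local piece is connected and so lies in one component.
--
-- For the normal form, a flow box for `g` supplies `nstar` functions `c` with `L_g c = 0`
-- completing `ξ` to a chart (`exists_adapted_coordinates`). With `η` the point of `Γ` having the
-- same `c`, the input enters only the last equation.
--
-- Conversely, the normal form gives `L_f^k ξ₁ = ξ_(k+1)` for `k < r`, so `ξ₁` has relative degree
-- `r`. No regularity of its factor through `h` is assumed; smooth local sections of the submersion
-- `h` provide it.
--
-- The smooth flow behind the flow box comes from inverting a smooth map built from the integral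
-- equation `α = x + s ∫ g ∘ α` on the Banach space of curves on `[0, 1]`.

universe u

/-! ### Smooth local inverses -/

/-- Inverse function theorem for smooth maps, with a smooth inverse on the whole target. -/
theorem ContDiffOn.exists_smooth_openPartialHomeomorph {E F : Type*} [NormedAddCommGroup E]
    [NormedSpace ℝ E] [CompleteSpace E] [NormedAddCommGroup F] [NormedSpace ℝ F]
    {f : E → F} {U : Set E} (hf : ContDiffOn ℝ ∞ f U) (hU : IsOpen U) {a : E} (ha : a ∈ U)
    {e : E ≃L[ℝ] F} (he : HasFDerivAt f (e : E →L[ℝ] F) a) :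
    ∃ Φ : OpenPartialHomeomorph E F, a ∈ Φ.source ∧ Φ.source ⊆ U ∧ (∀ x, Φ x = f x) ∧
      ContDiffOn ℝ ∞ Φ.symm Φ.target := by
  have hfa : ContDiffAt ℝ ∞ f a := hf.contDiffAt (hU.mem_nhds ha)
  have hS : IsOpen (U ∩ fderiv ℝ f ⁻¹' range ((↑) : (E ≃L[ℝ] F) → E →L[ℝ] F)) :=
    (hf.continuousOn_fderiv_of_isOpen hU (by simp)).isOpen_inter_preimage hU
      ContinuousLinearEquiv.isOpen
  let Φ₀ := hfa.toOpenPartialHomeomorph f he (by simp)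
  refine ⟨Φ₀.restrOpen _ hS, ?_, ?_, fun x => rfl, ?_⟩
  · exact ⟨hfa.mem_toOpenPartialHomeomorph_source he (by simp), ha, by
      rw [mem_preimage, he.fderiv]; exact ⟨e, rfl⟩⟩
  · exact fun x hx => hx.2.1
  · intro y hy
    have hy' := (Φ₀.restrOpen _ hS).map_target hy
    obtain ⟨hx0, hxU, e', he'⟩ := hy'
    have hxc : ContDiffAt ℝ ∞ f ((Φ₀.restrOpen _ hS).symm y) := hf.contDiffAt (hU.mem_nhds hxU)
    refine ((Φ₀.restrOpen _ hS).contDiffAt_symm hy (f₀' := e') ?_ hxc).contDiffWithinAt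
    rw [he']
    exact (hxc.differentiableAt (by simp)).hasFDerivAt

/-! ### Smoothness of superposition operators -/

section Superposition

variable {K : Type*} [TopologicalSpace K] [CompactSpace K]
  {E F : Type u} [NormedAddCommGroup E] [NormedSpace ℝ E] [NormedAddCommGroup F] [NormedSpace ℝ F]

/-- Pointwise application of a continuous family of operators, as a continuous linear map. -/
noncomputable def ContinuousMap.pointwiseApplyL :
    C(K, E →L[ℝ] F) →L[ℝ] C(K, E) →L[ℝ] C(K, F) :=
  LinearMap.mkContinuous₂
    (LinearMap.mk₂ ℝ (fun (A : C(K, E →L[ℝ] F)) (α : C(K, E)) =>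
        (⟨fun k => A k (α k), A.continuous.clm_apply α.continuous⟩ : C(K, F)))
      (fun _ _ _ => by ext; simp) (fun _ _ _ => by ext; simp)
      (fun _ _ _ => by ext; simp) (fun _ _ _ => by ext; simp)) 1
    (fun A α => by
      rw [one_mul]
      refine (ContinuousMap.norm_le _ (by positivity)).2 fun k => ?_
      exact ((A k).le_opNorm _).trans
        (mul_le_mul (A.norm_coe_le_norm k) (α.norm_coe_le_norm k) (norm_nonneg _) (norm_nonneg A)))

@[simp]
theorem ContinuousMap.pointwiseApplyL_apply (A : C(K, E →L[ℝ] F)) (α : C(K, E)) (k : K) :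
    ContinuousMap.pointwiseApplyL A α k = A k (α k) := rfl

/-- The mean value inequality at each `k` bounds the remainder by the oscillation of `g'` between `α
k` and points near it. Continuity of `β ↦ g' ∘ β` in the sup norm makes this bound uniform in `k`.
-/
theorem ContinuousMap.hasFDerivAt_comp_left {g : C(E, F)} {g' : C(E, E →L[ℝ] F)}
    (hg : ∀ x, HasFDerivAt g (g' x) x) (α : C(K, E)) :
    HasFDerivAt (fun β : C(K, E) => g.comp β) (pointwiseApplyL (g'.comp α)) α := by
  rw [hasFDerivAt_iff_isLittleO, Asymptotics.isLittleO_iff]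
  intro c hc
  have hcont : Continuous fun β : C(K, E) => g'.comp β := g'.continuous_postcomp
  have hdist : ∃ δ > 0, ∀ ⦃β : C(K, E)⦄, dist β α < δ → dist (g'.comp β) (g'.comp α) < c :=
    (Metric.continuousAt_iff (f := fun β : C(K, E) => g'.comp β) (a := α)).1 hcont.continuousAt c hc
  obtain ⟨δ, hδ, hball⟩ := hdist
  filter_upwards [Metric.ball_mem_nhds α hδ] with β hβ
  refine (ContinuousMap.norm_le _ (by positivity)).2 fun k => ?_
  have key := (convex_segment (𝕜 := ℝ) (α k) (β k)).norm_image_sub_le_of_norm_hasFDerivWithin_le'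
    (f := g) (f' := fun x => g' x) (φ := g' (α k)) (C := c)
    (fun x _ => (hg x).hasFDerivWithinAt) (fun x hx => ?_)
    (left_mem_segment ℝ _ _) (right_mem_segment ℝ _ _)
  · refine (le_of_eq ?_).trans (key.trans ?_)
    · simp
    · gcongr
      exact (β - α).norm_coe_le_norm k
  · obtain ⟨t, ht, rfl⟩ := (segment_eq_image_lineMap ℝ (α k) (β k)) ▸ hx
    -- The point of the segment is the value at `k` of a whole curve within `δ` of `α`, so the
    -- sup-norm estimate applies to it.
    have hmem : AffineMap.lineMap α β t ∈ Metric.ball α δ := by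
      rw [Metric.mem_ball, dist_lineMap_left]
      have h1 : ‖t‖ ≤ 1 := by rw [Real.norm_eq_abs, abs_of_nonneg ht.1]; exact ht.2
      have h2 : dist α β < δ := by rw [dist_comm]; exact hβ
      nlinarith [dist_nonneg (x := α) (y := β)]
    have h3 : dist (g'.comp (AffineMap.lineMap α β t)) (g'.comp α) ≤ c := (hball hmem).le
    refine le_trans (le_of_eq ?_) ((ContinuousMap.dist_apply_le_dist k).trans h3)
    rw [dist_eq_norm]
    simp [AffineMap.lineMap_apply]

/-- The derivative is again a superposition operator, with `g'` in place of `g`, followed by a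
continuous linear map. The induction therefore quantifies over the codomain `F`, which changes to `E
→L[ℝ] F`. -/
theorem ContinuousMap.contDiff_comp_left_nat (n : ℕ) : ∀ {F : Type u} [NormedAddCommGroup F]
    [NormedSpace ℝ F] {g : C(E, F)}, ContDiff ℝ n g →
    ContDiff ℝ n (fun β : C(K, E) => g.comp β) := by
  induction n with
  | zero =>
    intro F _ _ g _
    exact contDiff_zero.2 g.continuous_postcomp
  | succ n ih =>
    intro F _ _ g hg
    obtain ⟨g', hg', hd⟩ := contDiff_succ_iff_hasFDerivAt.1 hg
    refine contDiff_succ_iff_hasFDerivAt.2 ⟨fun α => pointwiseApplyL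
      ((⟨g', hg'.continuous⟩ : C(E, E →L[ℝ] F)).comp α), ?_, fun α => ?_⟩
    · exact pointwiseApplyL.contDiff.comp (ih (g := ⟨g', hg'.continuous⟩) hg')
    · exact hasFDerivAt_comp_left (g' := ⟨g', hg'.continuous⟩) hd α

/-- The superposition operator `β ↦ g ∘ β` on continuous maps is smooth if `g` is. -/
theorem ContinuousMap.contDiff_comp_left {g : C(E, F)} (hg : ContDiff ℝ ∞ g) :
    ContDiff ℝ ∞ (fun β : C(K, E) => g.comp β) :=
  contDiff_infty.2 fun n => contDiff_comp_left_nat n (contDiff_infty.1 hg n)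

end Superposition

/-! ### The integral operator on curves -/

section Primitive

variable {E : Type*} [NormedAddCommGroup E] [NormedSpace ℝ E]

/-- The primitive vanishing at `0`, as an operator on continuous curves on `[0, 1]`. -/
noncomputable def primitiveL : C(Icc (0 : ℝ) 1, E) →L[ℝ] C(Icc (0 : ℝ) 1, E) :=
  LinearMap.mkContinuous
    { toFun := fun α => ⟨fun t => ∫ τ in (0 : ℝ)..t, α (projIcc 0 1 zero_le_one τ), by
        have h : Continuous fun τ : ℝ => α (projIcc 0 1 zero_le_one τ) :=
          α.continuous.comp continuous_projIcc
        exact (intervalIntegral.continuous_primitive (fun a b => h.intervalIntegrable a b) 0).comp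
          continuous_subtype_val⟩
      map_add' := fun α β => by
        ext t
        exact intervalIntegral.integral_add
          ((α.continuous.comp continuous_projIcc).intervalIntegrable _ _)
          ((β.continuous.comp continuous_projIcc).intervalIntegrable _ _)
      map_smul' := fun c α => by
        ext t
        exact intervalIntegral.integral_smul c _ } 1
    (fun α => by
      rw [one_mul]
      refine (ContinuousMap.norm_le _ (norm_nonneg _)).2 fun t => ?_
      refine (intervalIntegral.norm_integral_le_of_norm_le_const
        (C := ‖α‖) fun x _ => α.norm_coe_le_norm _).trans ?_
      rw [sub_zero, abs_of_nonneg t.2.1]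
      exact mul_le_of_le_one_right (norm_nonneg _) t.2.2)

theorem primitiveL_apply (α : C(Icc (0 : ℝ) 1, E)) (t : Icc (0 : ℝ) 1) :
    primitiveL α t = ∫ τ in (0 : ℝ)..t, α (projIcc 0 1 zero_le_one τ) := rfl

end Primitive

/-! ### Smooth local flows and flow boxes -/

section Flow

/-- Continuous curves on `[0, 1]`. -/
abbrev UnitCurve (E : Type*) [TopologicalSpace E] : Type _ := C(Icc (0 : ℝ) 1, E)

variable {E : Type u} [NormedAddCommGroup E] [NormedSpace ℝ E]

theorem hasDerivWithinAt_primitiveL_one [CompleteSpace E] (α : C(Icc (0 : ℝ) 1, E)) :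
    HasDerivWithinAt (fun c : ℝ => primitiveL α (projIcc 0 1 zero_le_one c)) (α 1)
      (Icc 0 1) 1 := by
  have hc : Continuous fun τ : ℝ => α (projIcc 0 1 zero_le_one τ) :=
    α.continuous.comp continuous_projIcc
  have h := (intervalIntegral.integral_hasDerivAt_right (hc.intervalIntegrable 0 1)
    (hc.stronglyMeasurableAtFilter _ _) hc.continuousAt).hasDerivWithinAt (s := Icc 0 1)
  rw [projIcc_right] at h
  refine h.congr (fun c hcm => ?_) ?_
  · rw [primitiveL_apply, projIcc_of_mem _ hcm]
  · rw [primitiveL_apply, projIcc_right]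

/-- Substitution `τ ↦ c τ` in the integral; it shows that a time-rescaled solution of the integral
equation solves it with a rescaled time parameter. -/
theorem primitiveL_comp_mul (α : C(Icc (0 : ℝ) 1, E)) (c : Icc (0 : ℝ) 1) (t : Icc (0 : ℝ) 1) :
    (c : ℝ) • primitiveL
        (α.comp ⟨fun τ : Icc (0 : ℝ) 1 => (c * τ : Icc (0 : ℝ) 1), by fun_prop⟩) t =
      primitiveL α (c * t) := by
  rw [primitiveL_apply, primitiveL_apply]
  have h := intervalIntegral.smul_integral_comp_mul_left
    (fun τ : ℝ => α (projIcc 0 1 zero_le_one τ)) (c : ℝ) (a := 0) (b := t)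
  rw [mul_zero] at h
  refine Eq.trans ?_ h
  congr 1
  refine intervalIntegral.integral_congr fun τ hτ => ?_
  rw [uIcc_of_le t.2.1] at hτ
  have hτ1 : τ ∈ Icc (0 : ℝ) 1 := ⟨hτ.1, hτ.2.trans t.2.2⟩
  have hcτ : (c : ℝ) * τ ∈ Icc (0 : ℝ) 1 :=
    ⟨mul_nonneg c.2.1 hτ1.1, mul_le_one₀ c.2.2 hτ1.1 hτ1.2⟩
  simp only [ContinuousMap.comp_apply, ContinuousMap.coe_mk, projIcc_of_mem _ hτ1,
    projIcc_of_mem _ hcτ]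
  rfl

/-- A smooth vector field has a smooth local flow. -/
theorem ContDiff.exists_smooth_flow [CompleteSpace E] {g : E → E} (hg : ContDiff ℝ ∞ g) (x₀ : E) :
    ∃ (φ : E × ℝ → E) (O : Set (E × ℝ)), IsOpen O ∧ (x₀, 0) ∈ O ∧ ContDiffOn ℝ ∞ φ O ∧
      (∀ x, (x, 0) ∈ O → φ (x, 0) = x) ∧
      ∀ q ∈ O, fderiv ℝ φ q (0, 1) = g (φ q) := by
  let G : C(E, E) := ⟨g, hg.continuous⟩
  let cst : E →L[ℝ] UnitCurve E := ContinuousLinearMap.const ℝ _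
  -- A zero of `R` at `((x, s), α)` is a trajectory from `x` with time rescaled: `α τ` is the
  -- position at time `τ s`. Time thus becomes a parameter on the same footing as `x`.
  let R : (E × ℝ) × UnitCurve E → UnitCurve E := fun w =>
    w.2 - cst w.1.1 - w.1.2 • primitiveL (G.comp w.2)
  have hN : ContDiff ℝ ∞ fun w : (E × ℝ) × UnitCurve E => primitiveL (G.comp w.2) :=
    primitiveL.contDiff.comp ((ContinuousMap.contDiff_comp_left (g := G) hg).comp contDiff_snd)
  have hR : ContDiff ℝ ∞ R :=
    (contDiff_snd.sub (cst.contDiff.comp (contDiff_fst.comp contDiff_fst))).sub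
      ((contDiff_snd.comp contDiff_fst).smul hN)
  let w₀ : (E × ℝ) × UnitCurve E := ((x₀, 0), cst x₀)
  let T : E × ℝ →L[ℝ] UnitCurve E := -(cst.comp (ContinuousLinearMap.fst ℝ E ℝ)) -
    (ContinuousLinearMap.snd ℝ E ℝ).smulRight (primitiveL (G.comp (cst x₀)))
  -- At `s = 0` the integral term contributes nothing in the curve direction, so the derivative of
  -- `w ↦ (w.1, R w)` is block triangular with identity diagonal blocks.
  let e : ((E × ℝ) × UnitCurve E) ≃L[ℝ] ((E × ℝ) × UnitCurve E) :=
    ContinuousLinearEquiv.skewProd (.refl ℝ _) (.refl ℝ _) T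
  have hRd : HasFDerivAt R ((ContinuousLinearMap.snd ℝ (E × ℝ) (UnitCurve E)) +
      T.comp (ContinuousLinearMap.fst ℝ (E × ℝ) (UnitCurve E))) w₀ := by
    have h1 : HasFDerivAt (fun w : (E × ℝ) × UnitCurve E => w.2)
        (ContinuousLinearMap.snd ℝ (E × ℝ) (UnitCurve E)) w₀ :=
      hasFDerivAt_snd
    have h0 : HasFDerivAt (fun w : (E × ℝ) × UnitCurve E => w.1)
        (ContinuousLinearMap.fst ℝ (E × ℝ) (UnitCurve E)) w₀ :=
      hasFDerivAt_fst
    have h2 := cst.hasFDerivAt.comp w₀ h0.fst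
    have h3 := h0.snd.smul (hN.differentiable (by simp) w₀).hasFDerivAt
    refine ((h1.sub h2).sub h3).congr_fderiv ?_
    refine ContinuousLinearMap.ext fun w => ?_
    simp [T, w₀, sub_eq_add_neg, add_assoc]
  have hFd : HasFDerivAt (fun w : (E × ℝ) × UnitCurve E => (w.1, R w)) (e : _ →L[ℝ] _) w₀ := by
    refine (hasFDerivAt_fst.prodMk hRd).congr_fderiv ?_
    refine ContinuousLinearMap.ext fun w => ?_
    simp [e]
  obtain ⟨Φ, hw₀, -, hΦ, hΦs⟩ := ContDiffOn.exists_smooth_openPartialHomeomorph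
    (contDiff_fst.prodMk hR).contDiffOn isOpen_univ (mem_univ w₀) hFd
  have hRw₀ : R w₀ = 0 := by simp [R, w₀]
  have hΦw₀ : Φ w₀ = ((x₀, 0), 0) := by rw [hΦ, hRw₀]
  obtain ⟨δ, hδ, hball⟩ := Metric.isOpen_iff.1 Φ.open_source w₀ hw₀
  let A : E × ℝ → UnitCurve E := fun q => (Φ.symm (q, 0)).2
  let D : Set (E × ℝ) := (fun q : E × ℝ => (q, (0 : UnitCurve E))) ⁻¹' Φ.target
  have hD : IsOpen D := Φ.open_target.preimage (by fun_prop)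
  have hA : ContDiffOn ℝ ∞ A D :=
    contDiff_snd.comp_contDiffOn
      (hΦs.comp (contDiff_prodMk_left (0 : UnitCurve E)).contDiffOn fun q hq => hq)
  -- Both ball conditions survive replacing `s` by `c s` and the curve by its reparametrisation, so
  -- rescaled solutions stay where the local inverse gives uniqueness.
  let O : Set (E × ℝ) := (D ∩ A ⁻¹' Metric.ball (cst x₀) δ) ∩ Metric.ball (x₀, 0) δ
  have hO : IsOpen O :=
    (hA.continuousOn.isOpen_inter_preimage hD Metric.isOpen_ball).inter Metric.isOpen_ball
  have huniq : ∀ q α, (q, α) ∈ Φ.source → R (q, α) = 0 → A q = α := by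
    intro q α hs hz
    have : Φ (q, α) = (q, 0) := by rw [hΦ, hz]
    simp only [A]
    rw [← this, Φ.left_inv hs]
  have hsol : ∀ q ∈ D, R (q, A q) = 0 := by
    intro q hq
    have h := Φ.right_inv hq
    rw [hΦ] at h
    have h1 : (Φ.symm (q, 0)).1 = q := congrArg Prod.fst h
    have h2 : R (Φ.symm (q, 0)) = 0 := congrArg Prod.snd h
    have h3 : Φ.symm (q, 0) = (q, A q) := Prod.ext h1 rfl
    rwa [h3] at h2
  have hRapp : ∀ q α t, R (q, α) t = α t - q.1 - q.2 • primitiveL (G.comp α) t :=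
    fun _ _ _ => rfl
  have hsol' : ∀ q ∈ D, ∀ t, A q t = q.1 + q.2 • primitiveL (G.comp (A q)) t := by
    intro q hq t
    have h := DFunLike.congr_fun (hsol q hq) t
    rw [hRapp, ContinuousMap.zero_apply, sub_sub, sub_eq_zero] at h
    exact h
  have hOD : O ⊆ D := fun q hq => hq.1.1
  have hscale : ∀ q ∈ O, ∀ c : Icc (0 : ℝ) 1, A (q.1, c * q.2) 1 = A q c := by
    intro q hq c
    let m : C(Icc (0 : ℝ) 1, Icc (0 : ℝ) 1) := ⟨fun τ => c * τ, by fun_prop⟩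
    have h : A (q.1, c * q.2) = (A q).comp m := by
      refine huniq _ _ (hball ?_) ?_
      · rw [← ball_prod_same]
        refine ⟨?_, ?_⟩
        · have h1 : q ∈ Metric.ball (x₀, (0 : ℝ)) δ := hq.2
          rw [← ball_prod_same] at h1 ⊢
          refine ⟨h1.1, ?_⟩
          have h2 := h1.2
          simp only [Metric.mem_ball, dist_zero_right, norm_mul] at h2 ⊢
          refine lt_of_le_of_lt ?_ h2
          refine mul_le_of_le_one_left (norm_nonneg _) ?_
          rw [Real.norm_eq_abs, abs_of_nonneg c.2.1]
          exact c.2.2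
        · refine lt_of_le_of_lt ?_ (Metric.mem_ball.1 hq.1.2)
          refine (ContinuousMap.dist_le dist_nonneg).2 fun t => ?_
          exact (ContinuousMap.dist_apply_le_dist (f := A q) (g := cst x₀) (m t) :)
      · ext t
        rw [hRapp, ContinuousMap.zero_apply, sub_sub, sub_eq_zero]
        change A q (c * t) = q.1 + (c * q.2) • primitiveL ((G.comp (A q)).comp m) t
        rw [hsol' q (hOD hq), ← primitiveL_comp_mul, mul_comm, mul_smul]
    rw [h]
    change A q (c * 1) = _
    rw [mul_one]
  let ev : UnitCurve E →L[ℝ] E := ContinuousMap.evalCLM ℝ (1 : Icc (0 : ℝ) 1)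
  have hφ : ContDiffOn ℝ ∞ (fun q => ev (A q)) O := ev.contDiff.comp_contDiffOn (hA.mono hOD)
  have hφd : ∀ q ∈ O, HasFDerivAt (fun q => ev (A q)) (fderiv ℝ (fun q => ev (A q)) q) q :=
    fun q hq => ((hφ.contDiffAt (hO.mem_nhds hq)).differentiableAt (by simp)).hasFDerivAt
  have hline : ∀ q ∈ O, HasDerivAt (fun s : ℝ => ev (A (q.1, s)))
      (fderiv ℝ (fun q => ev (A q)) q (0, 1)) q.2 := fun q hq =>
    HasFDerivAt.comp_hasDerivAt (f := fun s : ℝ => (q.1, s)) q.2 (hφd q hq)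
      ((hasDerivAt_const q.2 q.1).prodMk (hasDerivAt_id q.2))
  refine ⟨fun q => ev (A q), O, hO, ?_, hφ, fun x hx => ?_, fun q hq => ?_⟩
  · have hAx : A (x₀, 0) = cst x₀ := huniq _ _ hw₀ hRw₀
    refine ⟨⟨?_, ?_⟩, Metric.mem_ball_self hδ⟩
    · change ((x₀, (0 : ℝ)), (0 : UnitCurve E)) ∈ Φ.target
      rw [← hΦw₀]
      exact Φ.map_source hw₀
    · rw [mem_preimage, hAx]
      exact Metric.mem_ball_self hδ
  · change A (x, 0) 1 = x
    rw [hsol' _ (hOD hx)]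
    simp
  · obtain ⟨x, s⟩ := q
    rcases eq_or_ne s 0 with rfl | hs
    -- At `s = 0` rescaling carries no information; instead `x + s Q(s)` is differentiated directly,
    -- with derivative `Q 0 = g x`.
    · let Q : ℝ → E := fun s => ev (primitiveL (G.comp (A (x, s))))
      have hQ : DifferentiableAt ℝ Q 0 := by
        have h1 : DifferentiableAt ℝ (fun s : ℝ => A (x, s)) 0 :=
          DifferentiableAt.comp (f := fun s : ℝ => (x, s)) 0
            ((hA.contDiffAt (hD.mem_nhds (hOD hq))).differentiableAt (by simp)) (by fun_prop)
        have h2 : Differentiable ℝ fun β : UnitCurve E => G.comp β :=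
          (ContinuousMap.contDiff_comp_left (g := G) hg).differentiable (by simp)
        exact (ev.comp primitiveL).differentiableAt.comp (0 : ℝ) ((h2 _).comp (0 : ℝ) h1)
      have hQd : HasDerivAt (fun s : ℝ => x + s • Q s) (Q 0) 0 := by
        simpa using ((hasDerivAt_id (0 : ℝ)).smul hQ.hasDerivAt).const_add x
      have hev : (fun s : ℝ => ev (A (x, s))) =ᶠ[𝓝 0] fun s => x + s • Q s := by
        have : ∀ᶠ s : ℝ in 𝓝 0, (x, s) ∈ D :=
          (hD.preimage (by fun_prop : Continuous fun s : ℝ => (x, s))).mem_nhds (hOD hq)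
        filter_upwards [this] with s hs
        exact hsol' _ hs 1
      have hAx : A (x, 0) = cst x := by
        ext t
        rw [hsol' _ (hOD hq)]
        simp [cst]
      have h := (hline _ hq).unique (hQd.congr_of_eventuallyEq hev)
      rw [h]
      change primitiveL (G.comp (A (x, 0))) 1 = g (A (x, 0) 1)
      rw [hAx, primitiveL_apply]
      simp [cst, G]
    -- For `s ≠ 0`, the position `A (x, c s) 1 = A (x, s) c` is differentiated in `c` at `c = 1` in
    -- two ways: by the chain rule, and by the integral equation. The factor `s` then cancels. The
    -- derivative is one-sided because `c ≤ 1`.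
    · have h1 : HasDerivWithinAt (fun c : ℝ => ev (A (x, c * s)))
          (s • fderiv ℝ (fun q => ev (A q)) (x, s) (0, 1)) (Icc 0 1) 1 := by
        have hm : HasDerivAt (fun c : ℝ => c * s) s 1 := by
          simpa using (hasDerivAt_id (1 : ℝ)).mul_const s
        have hl := hline (x, s) hq
        have hl' : HasDerivAt (fun s : ℝ => ev (A (x, s)))
          (fderiv ℝ (fun q => ev (A q)) (x, s) (0, 1)) (1 * s) := by rwa [one_mul]
        exact (hl'.scomp (1 : ℝ) hm).hasDerivWithinAt
      have h2 : HasDerivWithinAt (fun c : ℝ => ev (A (x, c * s))) (s • g (A (x, s) 1))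
          (Icc 0 1) 1 := by
        have h := ((hasDerivWithinAt_primitiveL_one (G.comp (A (x, s)))).const_smul s).const_add x
        refine h.congr (fun c hc => ?_) ?_
        · rw [Pi.smul_apply, projIcc_of_mem _ hc]
          exact (hscale _ hq ⟨c, hc⟩).trans (hsol' _ (hOD hq) _)
        · rw [Pi.smul_apply, projIcc_right]
          exact (hscale _ hq 1).trans (hsol' _ (hOD hq) _)
      have h := (uniqueDiffOn_Icc zero_lt_one 1 ⟨zero_le_one, le_rfl⟩).eq_deriv _ h1 h2
      exact smul_right_injective E hs h

/-- Straightening of a smooth vector field near a point where it does not vanish: in suitable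
smooth coordinates, tangent to the identity at the point, it is constant. -/
theorem ContDiff.exists_flowBox [CompleteSpace E] {g : E → E} (hg : ContDiff ℝ ∞ g) (x₀ : E)
    {ℓ : E →L[ℝ] ℝ} (hℓ : ℓ (g x₀) = 1) :
    ∃ (H : E → E) (S : Set E), IsOpen S ∧ x₀ ∈ S ∧ ContDiffOn ℝ ∞ H S ∧
      (∀ x ∈ S, fderiv ℝ H x (g x) = g x₀) ∧ HasFDerivAt H (ContinuousLinearMap.id ℝ E) x₀ := by
  obtain ⟨φ, O, hO, hxO, hφ, hφ0, hφg⟩ := hg.exists_smooth_flow x₀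
  -- `B` splits `z` into its part in `ker ℓ` and its coefficient along `g x₀`. The map `φ ∘ q` flows
  -- from the hyperplane `x₀ + ker ℓ` for time `ℓ z`; its local inverse is `H`.
  let B : E →L[ℝ] E × ℝ := (ContinuousLinearMap.id ℝ E - ℓ.smulRight (g x₀)).prod ℓ
  have hBg : B (g x₀) = (0, 1) := by simp [B, hℓ]
  let q : E → E × ℝ := fun z => (x₀, 0) + B z
  have hq : ContDiff ℝ ∞ q := contDiff_const.add B.contDiff
  have hqd : ∀ z, HasFDerivAt q B z := fun z => B.hasFDerivAt.const_add _
  have hq0 : q 0 = (x₀, 0) := by simp [q]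
  have hφd : ∀ w ∈ O, HasFDerivAt φ (fderiv ℝ φ w) w := fun w hw =>
    ((hφ.contDiffAt (hO.mem_nhds hw)).differentiableAt (by simp)).hasFDerivAt
  have hGd : ∀ z, q z ∈ O → HasFDerivAt (fun z => φ (q z)) ((fderiv ℝ φ (q z)).comp B) z :=
    fun z hz => (hφd _ hz).comp z (hqd z)
  have hφy : ∀ y, fderiv ℝ φ (x₀, 0) (y, 0) = y := by
    have h1 : HasFDerivAt (fun x : E => φ (x, 0)) ((fderiv ℝ φ (x₀, 0)).comp
        (ContinuousLinearMap.inl ℝ E ℝ)) x₀ :=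
      HasFDerivAt.comp (f := fun x : E => (x, (0 : ℝ))) x₀ (hφd _ hxO)
        (hasFDerivAt_prodMk_left x₀ (0 : ℝ))
    have h2 : (fun x : E => φ (x, 0)) =ᶠ[𝓝 x₀] id := by
      have : ∀ᶠ x : E in 𝓝 x₀, (x, (0 : ℝ)) ∈ O :=
        (hO.preimage (by fun_prop : Continuous fun x : E => (x, (0 : ℝ)))).mem_nhds hxO
      filter_upwards [this] with x hx using hφ0 x hx
    have h3 := h1.unique ((hasFDerivAt_id x₀).congr_of_eventuallyEq h2)
    exact fun y => by simpa using DFunLike.congr_fun h3 y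
  have hG0 : HasFDerivAt (fun z => φ (q z)) ((ContinuousLinearEquiv.refl ℝ E : E ≃L[ℝ] E) :
      E →L[ℝ] E) 0 := by
    refine (hGd 0 (hq0 ▸ hxO)).congr_fderiv ?_
    refine ContinuousLinearMap.ext fun z => ?_
    have hz : B z = (z - ℓ z • g x₀, 0) + ℓ z • ((0 : E), (1 : ℝ)) := by simp [B]
    rw [ContinuousLinearMap.comp_apply, hz, map_add, map_smul, hq0, hφy, hφg _ hxO, hφ0 _ hxO]
    simp
  have hcd : ContDiffOn ℝ ∞ (fun z => φ (q z)) (q ⁻¹' O) := hφ.comp hq.contDiffOn fun _ hz => hz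
  obtain ⟨Φ, h0, hsub, hΦ, hΦs⟩ := hcd.exists_smooth_openPartialHomeomorph
    (hO.preimage hq.continuous) (show (0 : E) ∈ q ⁻¹' O from (hq0 ▸ hxO : q 0 ∈ O)) hG0
  have hΦ0 : Φ 0 = x₀ := by rw [hΦ, hq0, hφ0 _ hxO]
  have hsd : ∀ x ∈ Φ.target, HasFDerivAt Φ.symm (fderiv ℝ Φ.symm x) x := fun x hx =>
    ((hΦs.contDiffAt (Φ.open_target.mem_nhds hx)).differentiableAt (by simp)).hasFDerivAt
  have hinv : ∀ z ∈ Φ.source, ∀ L, HasFDerivAt (fun z => φ (q z)) L z →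
      (fderiv ℝ Φ.symm (Φ z)).comp L = ContinuousLinearMap.id ℝ E := by
    intro z hz L hL
    have hL' : HasFDerivAt Φ L z := hL.congr_of_eventuallyEq (.of_forall hΦ)
    have h1 := (hsd _ (Φ.map_source hz)).comp z hL'
    have h2 : (Φ.symm ∘ Φ) =ᶠ[𝓝 z] id := by
      filter_upwards [Φ.open_source.mem_nhds hz] with y hy using Φ.left_inv hy
    exact h1.unique ((hasFDerivAt_id z).congr_of_eventuallyEq h2)
  have hx₀t : x₀ ∈ Φ.target := hΦ0 ▸ Φ.map_source h0
  refine ⟨Φ.symm, Φ.target, Φ.open_target, hx₀t, hΦs, fun x hx => ?_, ?_⟩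
  · have hz := Φ.map_target hx
    have h1 := DFunLike.congr_fun (hinv _ hz _ (hGd _ (hsub hz))) (g x₀)
    rw [ContinuousLinearMap.comp_apply, ContinuousLinearMap.comp_apply, hBg, hφg _ (hsub hz),
      ← hΦ, Φ.right_inv hx] at h1
    exact h1
  · have h1 := hinv 0 h0 _ hG0
    rw [hΦ0] at h1
    exact (hsd x₀ hx₀t).congr_fderiv h1

end Flow

/-! ### Iterated Lie derivatives and relative degree -/

section LieDerivative

variable {n : ℕ} {f g : Eu n → Eu n} {μ : Eu n → ℝ} {V : Set (Eu n)}

theorem ContDiffOn.lieD {v : Eu n → Eu n} (hμ : ContDiffOn ℝ ∞ μ V) (hv : ContDiff ℝ ∞ v)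
    (hV : IsOpen V) : ContDiffOn ℝ ∞ (lieD v μ) V :=
  (hμ.fderiv_of_isOpen hV (by simp)).clm_apply hv.contDiffOn

theorem ContDiffOn.iterate_lieD (hμ : ContDiffOn ℝ ∞ μ V) (hf : ContDiff ℝ ∞ f)
    (hV : IsOpen V) (k : ℕ) : ContDiffOn ℝ ∞ ((_root_.lieD f)^[k] μ) V := by
  induction k with
  | zero => exact hμ
  | succ k ih =>
    rw [Function.iterate_succ_apply']
    exact ih.lieD hf hV

theorem lieD_eq_zero_of_eqOn_zero (v : Eu n → Eu n) (hV : IsOpen V) (h : ∀ x ∈ V, μ x = 0)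
    {x : Eu n} (hx : x ∈ V) : lieD v μ x = 0 := by
  have : μ =ᶠ[𝓝 x] fun _ => 0 := by
    filter_upwards [hV.mem_nhds hx] with y hy using h y hy
  rw [lieD, this.fderiv_eq]
  simp

/-- The iterated bracket `ad_f^j g`. -/
noncomputable def adField (f g : Eu n → Eu n) (j : ℕ) : Eu n → Eu n :=
  (VectorField.lieBracket ℝ f)^[j] g

theorem contDiff_adField (hf : ContDiff ℝ ∞ f) (hg : ContDiff ℝ ∞ g) (j : ℕ) :
    ContDiff ℝ ∞ (adField f g j) := by
  induction j with
  | zero => exact hg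
  | succ j ih =>
    rw [adField, Function.iterate_succ_apply']
    exact hf.lieBracket_vectorField ih (by simp)

theorem lieD_adField_succ (hf : ContDiff ℝ ∞ f) (hg : ContDiff ℝ ∞ g) (hμ : ContDiffOn ℝ ∞ μ V)
    (hV : IsOpen V) (j : ℕ) {x : Eu n} (hx : x ∈ V) :
    lieD (adField f g (j + 1)) μ x =
      lieD f (lieD (adField f g j) μ) x - lieD (adField f g j) (lieD f μ) x := by
  rw [adField, Function.iterate_succ_apply']
  exact VectorField.fderiv_apply_lieBracket (n := ∞) (hμ.contDiffAt (hV.mem_nhds hx))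
    (by
      rw [minSmoothness_of_isRCLikeNormedField]
      exact WithTop.coe_le_coe.2 (le_top : (2 : ℕ∞) ≤ ⊤))
    ((contDiff_adField hf hg j).differentiable (by simp) x) (hf.differentiable (by simp) x)

variable {r : ℕ}

/-- By `L_[f,v] = L_f L_v - L_v L_f`, each bracket with `f` trades for one more `L_f` on the output,
so only the total `j + k` matters. -/
theorem lieD_adField_iterate_eq_zero (hf : ContDiff ℝ ∞ f) (hg : ContDiff ℝ ∞ g)
    (hμ : ContDiffOn ℝ ∞ μ V) (hV : IsOpen V)
    (h0 : ∀ k, k + 1 < r → ∀ x ∈ V, lieD g ((lieD f)^[k] μ) x = 0) (j : ℕ) :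
    ∀ k, j + k + 1 < r → ∀ x ∈ V, lieD (adField f g j) ((lieD f)^[k] μ) x = 0 := by
  induction j with
  | zero => exact fun k hk => h0 k (by omega)
  | succ j ih =>
    intro k hk x hx
    rw [lieD_adField_succ hf hg (hμ.iterate_lieD hf hV k) hV j hx,
      lieD_eq_zero_of_eqOn_zero f hV (ih k (by omega)) hx, ← Function.iterate_succ_apply' (lieD f),
      ih (k + 1) (by omega) x hx, sub_zero]

/-- On the critical antidiagonal the term `L_f L_v` still vanishes by the previous lemma, and the
surviving term changes sign at each bracket. -/
theorem lieD_adField_iterate_eq (hf : ContDiff ℝ ∞ f) (hg : ContDiff ℝ ∞ g)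
    (hμ : ContDiffOn ℝ ∞ μ V) (hV : IsOpen V)
    (h0 : ∀ k, k + 1 < r → ∀ x ∈ V, lieD g ((lieD f)^[k] μ) x = 0) (j : ℕ) :
    ∀ k, j + k + 1 = r → ∀ x ∈ V, lieD (adField f g j) ((lieD f)^[k] μ) x =
      (-1) ^ j * lieD g ((lieD f)^[r - 1] μ) x := by
  induction j with
  | zero =>
    intro k hk x _
    obtain rfl : r - 1 = k := by omega
    simp [adField]
  | succ j ih =>
    intro k hk x hx
    rw [lieD_adField_succ hf hg (hμ.iterate_lieD hf hV k) hV j hx,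
      lieD_eq_zero_of_eqOn_zero f hV
        (lieD_adField_iterate_eq_zero hf hg hμ hV h0 j k (by omega)) hx,
      ← Function.iterate_succ_apply' (lieD f), ih (k + 1) (by omega) x hx]
    ring

/-- The vector `(μ, L_f μ, …, L_f^(r-1) μ)`. -/
noncomputable def lieChain (f : Eu n → Eu n) (μ : Eu n → ℝ) (r : ℕ) (x : Eu n) : Eu r :=
  WithLp.toLp 2 fun i => (lieD f)^[i] μ x

theorem lieChain_eq_zero_iff {x : Eu n} :
    lieChain f μ r x = 0 ↔ ∀ k < r, (lieD f)^[k] μ x = 0 := by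
  constructor
  · intro h k hk
    exact congrArg (fun v : Eu r => v ⟨k, hk⟩) h
  · intro h
    ext i
    exact h i i.2

theorem ContDiffOn.lieChain (hμ : ContDiffOn ℝ ∞ μ V) (hf : ContDiff ℝ ∞ f) (hV : IsOpen V) :
    ContDiffOn ℝ ∞ (lieChain f μ r) V :=
  contDiffOn_euclidean.2 fun i => hμ.iterate_lieD hf hV i

theorem fderiv_euclidean_apply {m k : ℕ} {F : Eu m → Eu k} {x : Eu m}
    (hF : DifferentiableAt ℝ F x) (w : Eu m) (i : Fin k) :
    fderiv ℝ F x w i = fderiv ℝ (fun y => F y i) x w := by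
  have h : HasFDerivAt (fun y => F y i) (PiLp.proj 2 _ i ∘L fderiv ℝ F x) x :=
    (PiLp.proj (𝕜 := ℝ) 2 (fun _ : Fin k => ℝ) i).hasFDerivAt.comp x hF.hasFDerivAt
  rw [h.fderiv]
  rfl

/-- A functional `F` vanishing on the range is tested on the vectors `ad_f^j g x`; triangularity of
the resulting system forces its coefficients to vanish from the last one downwards. -/
theorem surjective_fderiv_lieChain (hf : ContDiff ℝ ∞ f) (hg : ContDiff ℝ ∞ g)
    (hμ : ContDiffOn ℝ ∞ μ V) (hV : IsOpen V)
    (h0 : ∀ k, k + 1 < r → ∀ x ∈ V, lieD g ((lieD f)^[k] μ) x = 0) {x : Eu n} (hx : x ∈ V)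
    (hne : lieD g ((lieD f)^[r - 1] μ) x ≠ 0) :
    Function.Surjective (fderiv ℝ (lieChain f μ r) x) := by
  have hd : DifferentiableAt ℝ (lieChain f μ r) x :=
    ((hμ.lieChain hf hV).contDiffAt (hV.mem_nhds hx)).differentiableAt (by simp)
  by_contra hns
  have hlt : LinearMap.range (fderiv ℝ (lieChain f μ r) x : Eu n →ₗ[ℝ] Eu r) < ⊤ :=
    lt_top_iff_ne_top.2 fun h => hns (LinearMap.range_eq_top.1 h)
  obtain ⟨F, hF, hle⟩ := Submodule.exists_le_ker_of_lt_top _ hlt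
  let e := EuclideanSpace.basisFun (Fin r) ℝ
  have hsum : ∀ w, ∑ i : Fin r, fderiv ℝ ((lieD f)^[i] μ) x w * F (e i) = 0 := by
    intro w
    have h1 : F (fderiv ℝ (lieChain f μ r) x w) = 0 := hle ⟨w, rfl⟩
    rw [← e.sum_repr (fderiv ℝ (lieChain f μ r) x w), map_sum] at h1
    rw [← h1]
    refine Finset.sum_congr rfl fun i _ => ?_
    rw [map_smul, smul_eq_mul, EuclideanSpace.basisFun_repr, fderiv_euclidean_apply hd]
    rfl
  have hc : ∀ j, ∀ i : Fin r, j + i + 1 = r → F (e i) = 0 := by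
    intro j
    induction j using Nat.strong_induction_on with
    | _ j ih =>
      intro i hi
      have h1 := hsum (adField f g j x)
      rw [Finset.sum_eq_single i ?_ (by simp)] at h1
      · have h2 := lieD_adField_iterate_eq hf hg hμ hV h0 j i hi x hx
        rw [lieD] at h2
        rw [h2] at h1
        exact (mul_eq_zero.1 h1).resolve_left (mul_ne_zero (by simp) hne)
      -- Below index `i` the Lie derivative vanishes; above it the coefficient of `F` is already
      -- zero by induction, as `r - 1 - k < j`.
      · intro k _ hki
        rcases lt_or_gt_of_ne (fun h => hki (Fin.ext h) : (k : ℕ) ≠ i) with hlt | hgt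
        · have h2 := lieD_adField_iterate_eq_zero hf hg hμ hV h0 j k (by omega) x hx
          rw [lieD] at h2
          rw [h2, zero_mul]
        · rw [ih (r - 1 - k) (by omega) k (by omega), mul_zero]
  refine hF (e.toBasis.ext fun i => ?_)
  simpa using hc (r - 1 - i) i (by omega)

/-- On a controlled invariant set where `μ` vanishes, so do its iterated Lie derivatives below the
relative degree. -/
theorem IsControlledInvariant.iterate_lieD_eq_zero {Γ : Set (Eu n)}
    (hinv : IsControlledInvariant f g Γ) (hf : ContDiff ℝ ∞ f)
    (hμ : ContDiffOn ℝ ∞ μ V) (hV : IsOpen V)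
    (h0 : ∀ k, k + 1 < r → ∀ x ∈ V, lieD g ((lieD f)^[k] μ) x = 0)
    (hΓ : ∀ x ∈ Γ ∩ V, μ x = 0) (k : ℕ) (hk : k < r) :
    ∀ x ∈ Γ ∩ V, (lieD f)^[k] μ x = 0 := by
  obtain ⟨u, -, v, hv, hvu, hvi⟩ := hinv
  induction k with
  | zero => exact hΓ
  | succ k ih =>
    intro x hx
    have ih' := ih (by omega)
    obtain ⟨γ, hγ0, ε, hε, hγ⟩ :=
      (hv.contDiffAt (x := x)).of_le (by simp : (1 : WithTop ℕ∞) ≤ ∞)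
        |>.exists_forall_mem_closedBall_exists_eq_forall_mem_Ioo_hasDerivAt₀ 0
    have hγΓ : ∀ t ∈ Ico 0 ε, γ t ∈ Γ := by
      refine hvi ε γ (hγ0 ▸ hx.1) fun t ht => (hγ t ⟨?_, ?_⟩).hasDerivWithinAt
      · linarith [ht.1]
      · linarith [ht.2]
    have hγd := hγ 0 ⟨by linarith, by linarith⟩
    have hmd : HasFDerivAt ((lieD f)^[k] μ) (fderiv ℝ ((lieD f)^[k] μ) (γ 0)) (γ 0) :=
      (((hμ.iterate_lieD hf hV k).contDiffAt
        (hV.mem_nhds (hγ0 ▸ hx.2))).differentiableAt (by simp)).hasFDerivAt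
    have h1 := (hmd.comp_hasDerivAt 0 hγd).hasDerivWithinAt (s := Ici 0)
    -- Invariance is only forward in time, so the function is known to vanish only for `t ≥ 0`; a
    -- one-sided derivative suffices.
    have h2 : HasDerivWithinAt (((lieD f)^[k] μ) ∘ γ) 0 (Ici 0) 0 := by
      refine (hasDerivWithinAt_const (0 : ℝ) (Ici 0) (0 : ℝ)).congr_of_eventuallyEq ?_
        (ih' _ (hγ0 ▸ hx))
      have e1 : ∀ᶠ t in 𝓝[≥] (0 : ℝ), t ∈ Ico 0 ε := Ico_mem_nhdsGE hε
      have e2 : ∀ᶠ t in 𝓝[≥] (0 : ℝ), γ t ∈ V :=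
        (hγd.continuousAt.mono_left nhdsWithin_le_nhds).eventually (hV.mem_nhds (hγ0 ▸ hx.2))
      filter_upwards [e1, e2] with t ht1 ht2
      exact ih' _ ⟨hγΓ t ht1, ht2⟩
    have h3 := (uniqueDiffOn_Ici (0 : ℝ) 0 self_mem_Ici).eq_deriv _ h1 h2
    -- The derivative along the curve is `L_f + u L_g` applied to `L_f^k μ`, and the `L_g` term is
    -- zero because `k + 1 < r`.
    rw [hγ0, hvu x hx.1, map_add, map_smul] at h3
    have h4 := h0 k hk x hx.2
    rw [lieD] at h4
    rw [h4, smul_zero, add_zero] at h3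
    rw [Function.iterate_succ_apply']
    exact h3

end LieDerivative

/-! ### Local identification of the target set and adapted charts -/

/-- A submanifold that is locally contained in the zero set of a submersion of the same codimension
locally coincides with it. -/
theorem IsEmbeddedSubmanifold.eventually_mem_iff {n d : ℕ} {Γ : Set (Eu n)}
    (hΓ : IsEmbeddedSubmanifold d Γ) {x₀ : Eu n} (hx₀ : x₀ ∈ Γ) {V : Set (Eu n)} (hV : IsOpen V)
    (hxV : x₀ ∈ V) {ξ : Eu n → Eu (n - d)} (hξ : ContDiffOn ℝ ∞ ξ V)
    (hξ0 : ∀ x ∈ Γ ∩ V, ξ x = 0) (hsurj : Function.Surjective (fderiv ℝ ξ x₀)) :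
    ∀ᶠ x in 𝓝 x₀, x ∈ Γ ↔ ξ x = 0 := by
  obtain ⟨φ, hxφ, hφ, hφs, himg⟩ := hΓ x₀ hx₀
  have hmem : ∀ x ∈ φ.source, (x ∈ Γ ↔ (φ x).2 = 0) := by
    intro x hx
    constructor
    · intro h
      exact (himg ▸ mem_image_of_mem φ ⟨h, hx⟩ : φ x ∈ φ.target ∩ {z | z.2 = 0}).2
    · intro h
      obtain ⟨y, hy, hyx⟩ : φ x ∈ φ '' (Γ ∩ φ.source) := himg ▸ ⟨φ.map_source hx, h⟩
      exact φ.injOn hy.2 hx hyx ▸ hy.1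
  let z₀ := φ x₀
  have hz₀t : z₀ ∈ φ.target := φ.map_source hxφ
  have hz₀2 : z₀.2 = 0 := (hmem x₀ hxφ).1 hx₀
  have hsz₀ : φ.symm z₀ = x₀ := φ.left_inv hxφ
  let D : Set (Eu d × Eu (n - d)) := φ.target ∩ φ.symm ⁻¹' V
  have hD : IsOpen D := φ.symm.continuousOn.isOpen_inter_preimage φ.open_target hV
  have hz₀D : z₀ ∈ D := ⟨hz₀t, by rw [mem_preimage, hsz₀]; exact hxV⟩
  have hρ : ContDiffOn ℝ ∞ (fun z => ξ (φ.symm z)) D :=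
    hξ.comp (hφs.mono inter_subset_left) fun z hz => hz.2
  have hρ0 : ∀ y, (y, 0) ∈ D → ξ (φ.symm (y, 0)) = 0 := fun y hy =>
    hξ0 _ ⟨(hmem _ (φ.map_target hy.1)).2 (by rw [φ.right_inv hy.1]), hy.2⟩
  have hs : HasFDerivAt φ.symm (fderiv ℝ φ.symm z₀) z₀ :=
    ((hφs.contDiffAt (φ.open_target.mem_nhds hz₀t)).differentiableAt (by simp)).hasFDerivAt
  have hφd : HasFDerivAt φ (fderiv ℝ φ x₀) x₀ :=
    ((hφ.contDiffAt (φ.open_source.mem_nhds hxφ)).differentiableAt (by simp)).hasFDerivAt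
  have hξd : HasFDerivAt ξ (fderiv ℝ ξ x₀) (φ.symm z₀) := by
    rw [hsz₀]
    exact ((hξ.contDiffAt (hV.mem_nhds hxV)).differentiableAt (by simp)).hasFDerivAt
  let R := (fderiv ℝ ξ x₀).comp (fderiv ℝ φ.symm z₀)
  have hR : HasFDerivAt (fun z => ξ (φ.symm z)) R z₀ := hξd.comp z₀ hs
  have hsφ : ∀ w, fderiv ℝ φ.symm z₀ (fderiv ℝ φ x₀ w) = w := by
    have h1 : HasFDerivAt (φ.symm ∘ φ) _ x₀ := hs.comp x₀ hφd
    have h2 : (φ.symm ∘ φ) =ᶠ[𝓝 x₀] id := by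
      filter_upwards [φ.open_source.mem_nhds hxφ] with y hy using φ.left_inv hy
    exact DFunLike.congr_fun (h1.unique ((hasFDerivAt_id x₀).congr_of_eventuallyEq h2))
  have hRsurj : Function.Surjective R := fun y => by
    obtain ⟨w, rfl⟩ := hsurj y
    exact ⟨fderiv ℝ φ x₀ w, by simp [R, hsφ]⟩
  have hz₀e : z₀ = (z₀.1, 0) := Prod.ext rfl hz₀2
  have hR1 : ∀ y, R (y, 0) = 0 := by
    have h1 : HasFDerivAt (fun y => ξ (φ.symm (y, 0))) (R.comp (ContinuousLinearMap.inl ℝ _ _))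
        z₀.1 := HasFDerivAt.comp (g := fun z => ξ (φ.symm z))
          (f := fun y => (y, (0 : Eu (n - d)))) z₀.1 (hz₀e ▸ hR)
          (hasFDerivAt_prodMk_left z₀.1 (0 : Eu (n - d)))
    have h2 : (fun y => ξ (φ.symm (y, 0))) =ᶠ[𝓝 z₀.1] fun _ => 0 := by
      have : ∀ᶠ y in 𝓝 z₀.1, (y, (0 : Eu (n - d))) ∈ D :=
        (hD.preimage (by fun_prop : Continuous fun y => (y, (0 : Eu (n - d))))).mem_nhds
          (show (z₀.1, (0 : Eu (n - d))) ∈ D from hz₀e ▸ hz₀D)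
      filter_upwards [this] with y hy using hρ0 y hy
    exact fun y => by
      simpa using DFunLike.congr_fun (h1.unique ((hasFDerivAt_const _ _).congr_of_eventuallyEq h2)) y
  -- `R` is onto and kills the directions tangent to the slice, so its transverse block is a
  -- surjective endomorphism of `Eu (n - d)`, hence injective.
  have hRinj : Function.Injective fun w => R (0, w) := by
    refine (LinearMap.injective_iff_surjective
      (f := (R.comp (ContinuousLinearMap.inr ℝ _ _) : Eu (n - d) →ₗ[ℝ] Eu (n - d)))).2 fun y => ?_
    obtain ⟨⟨a, b⟩, rfl⟩ := hRsurj y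
    refine ⟨b, ?_⟩
    have : R (a, b) = R (a, 0) + R (0, b) := by rw [← map_add]; simp
    rw [this, hR1, zero_add]
    rfl
  let M := (ContinuousLinearMap.fst ℝ (Eu d) (Eu (n - d))).prod R
  have hMinj : Function.Injective (M : Eu d × Eu (n - d) →ₗ[ℝ] Eu d × Eu (n - d)) := by
    refine (injective_iff_map_eq_zero _).2 fun ⟨a, b⟩ hab => ?_
    have ha : a = 0 := congrArg Prod.fst hab
    have hb : R (a, b) = 0 := congrArg Prod.snd hab
    subst ha
    rw [hRinj (hb.trans (map_zero R).symm : R (0, b) = R (0, 0))]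
    rfl
  obtain ⟨Φ, hzΦ, hΦD, hΦ, -⟩ := ContDiffOn.exists_smooth_openPartialHomeomorph
    (f := fun z => (z.1, ξ (φ.symm z))) (contDiff_fst.contDiffOn.prodMk hρ) hD hz₀D
    (e := (LinearEquiv.ofInjectiveEndo _ hMinj).toContinuousLinearEquiv)
    (HasFDerivAt.prodMk (f₁ := Prod.fst) hasFDerivAt_fst hR)
  have hcont : ContinuousAt φ x₀ := φ.continuousAt hxφ
  have hcont' : ContinuousAt (fun x => ((φ x).1, (0 : Eu (n - d)))) x₀ :=
    hcont.fst.prodMk continuousAt_const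
  filter_upwards [φ.open_source.mem_nhds hxφ, hV.mem_nhds hxV,
    hcont.eventually (Φ.open_source.mem_nhds hzΦ),
    hcont'.eventually (Φ.open_source.mem_nhds
      (show (z₀.1, 0) ∈ Φ.source from hz₀e ▸ hzΦ))] with x h1 h2 h3 h4
  refine ⟨fun h => hξ0 x ⟨h, h2⟩, fun h => (hmem x h1).2 ?_⟩
  -- When `ξ x = 0`, the point `φ x` and its projection to the slice have the same first coordinate
  -- and the same `ξ`-value; local injectivity identifies them.
  have h5 : Φ (φ x) = Φ ((φ x).1, 0) := by
    rw [hΦ, hΦ, hρ0 _ (hΦD h4), φ.left_inv h1, h]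
  exact congrArg Prod.snd (Φ.injOn h3 h4 h5)

/-- A submersion can be completed to smooth coordinates by first integrals of a vector field which
is transverse to its fibres; the coordinate domain can be taken to be a product of balls. -/
theorem exists_adapted_coordinates {n d : ℕ} (hdn : d ≤ n) {g : Eu n → Eu n} (hg : ContDiff ℝ ∞ g)
    {V : Set (Eu n)} (hV : IsOpen V) {x₀ : Eu n} (hxV : x₀ ∈ V) {ξ : Eu n → Eu (n - d)}
    (hξ : ContDiffOn ℝ ∞ ξ V) (hsurj : Function.Surjective (fderiv ℝ ξ x₀))
    (hgξ : fderiv ℝ ξ x₀ (g x₀) ≠ 0) (hξ0 : ξ x₀ = 0) :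
    ∃ (Θ : OpenPartialHomeomorph (Eu n) (Eu d × Eu (n - d))) (y₀ : Eu d) (δ : ℝ), 0 < δ ∧
      x₀ ∈ Θ.source ∧ Θ.source ⊆ V ∧ (∀ x, (Θ x).2 = ξ x) ∧ ContDiffOn ℝ ∞ Θ Θ.source ∧
      ContDiffOn ℝ ∞ Θ.symm Θ.target ∧ Θ.target = Metric.ball y₀ δ ×ˢ Metric.ball 0 δ ∧
      ∀ x ∈ Θ.source, fderiv ℝ (fun x => (Θ x).1) x (g x) = 0 := by
  have hg0 : g x₀ ≠ 0 := fun h => hgξ (by rw [h, map_zero])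
  obtain ⟨ℓ, hℓ⟩ := SeparatingDual.exists_eq_one (R := ℝ) hg0
  obtain ⟨H, S, hS, hxS, hH, hHg, hHd⟩ := hg.exists_flowBox x₀ hℓ
  let ξ' : Eu n →ₗ[ℝ] Eu (n - d) := fderiv ℝ ξ x₀
  have hfin : Module.finrank ℝ (LinearMap.ker ξ') = Module.finrank ℝ (Eu d) := by
    have h1 := ξ'.finrank_range_add_finrank_ker
    rw [LinearMap.range_eq_top.2 (hsurj : Function.Surjective ξ'), finrank_top] at h1
    simp only [finrank_euclideanSpace, Fintype.card_fin] at h1 ⊢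
    omega
  let E₁ := LinearEquiv.ofFinrankEq _ _ hfin
  -- Since `g x₀` is transverse to `ker ξ'`, a left inverse of `J` gives a linear `L` that kills `g
  -- x₀` and is an isomorphism on `ker ξ'`. Then `L ∘ H` is constant along `g`, and together with
  -- `ξ` it has invertible derivative at `x₀`.
  let J : LinearMap.ker ξ' × ℝ →ₗ[ℝ] Eu n :=
    (LinearMap.ker ξ').subtype.coprod (LinearMap.toSpanSingleton ℝ _ (g x₀))
  have hJ : LinearMap.ker J = ⊥ := by
    refine LinearMap.ker_eq_bot'.2 fun ⟨m, s⟩ hms => ?_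
    have h1 : (m : Eu n) + s • g x₀ = 0 := hms
    have h2 := congrArg ξ' h1
    rw [map_add, m.2, map_smul, map_zero, zero_add] at h2
    have hs : s = 0 := (smul_eq_zero.1 h2).resolve_right hgξ
    subst hs
    rw [zero_smul, add_zero] at h1
    exact Prod.ext (Subtype.ext h1) rfl
  obtain ⟨Q, hQ⟩ := J.exists_leftInverse_of_injective hJ
  let L : Eu n →ₗ[ℝ] Eu d := E₁.toLinearMap ∘ₗ LinearMap.fst ℝ _ _ ∘ₗ Q
  have hLg : L (g x₀) = 0 := by
    have h := LinearMap.congr_fun hQ (0, 1)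
    simp only [J, LinearMap.comp_apply, LinearMap.coprod_apply, map_zero, zero_add,
      LinearMap.toSpanSingleton_apply, one_smul, LinearMap.id_apply] at h
    simp [L, h]
  have hLm : ∀ m : LinearMap.ker ξ', L m = E₁ m := by
    intro m
    have h := LinearMap.congr_fun hQ (m, 0)
    simp only [J, LinearMap.comp_apply, LinearMap.coprod_apply, map_zero, add_zero,
      Submodule.subtype_apply, LinearMap.id_apply] at h
    simp [L, h]
  let Lc : Eu n →L[ℝ] Eu d := LinearMap.toContinuousLinearMap L
  have hinj : Function.Injective (L.prod ξ') := by
    refine (injective_iff_map_eq_zero _).2 fun w hw => ?_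
    have h1 : L w = 0 := congrArg Prod.fst hw
    have h2 : ξ' w = 0 := congrArg Prod.snd hw
    have h3 := hLm ⟨w, h2⟩
    rw [h1] at h3
    exact congrArg Subtype.val ((LinearEquiv.map_eq_zero_iff E₁).1 h3.symm)
  have hdim : Module.finrank ℝ (Eu n) = Module.finrank ℝ (Eu d × Eu (n - d)) := by
    rw [Module.finrank_prod]
    simp only [finrank_euclideanSpace, Fintype.card_fin]
    omega
  have hξd : HasFDerivAt ξ (fderiv ℝ ξ x₀) x₀ :=
    ((hξ.contDiffAt (hV.mem_nhds hxV)).differentiableAt (by simp)).hasFDerivAt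
  have hc : ContDiffOn ℝ ∞ (fun x => (Lc (H x), ξ x)) (V ∩ S) :=
    (Lc.contDiff.comp_contDiffOn (hH.mono inter_subset_right)).prodMk (hξ.mono inter_subset_left)
  obtain ⟨Θ₀, hx₀, hsub, hΘ, hΘs⟩ := hc.exists_smooth_openPartialHomeomorph (hV.inter hS)
    (⟨hxV, hxS⟩ : x₀ ∈ V ∩ S)
    (e := (LinearMap.linearEquivOfInjective _ hinj hdim).toContinuousLinearEquiv)
    (((Lc.hasFDerivAt.comp x₀ hHd).prodMk hξd).congr_fderiv
      (ContinuousLinearMap.ext fun w => rfl))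
  obtain ⟨δ, hδ, hball⟩ := Metric.isOpen_iff.1 Θ₀.open_target _ (Θ₀.map_source hx₀)
  have hΘx : Θ₀ x₀ = (Lc (H x₀), 0) := by rw [hΘ, hξ0]
  rw [hΘx, ← ball_prod_same] at hball
  -- The product shape keeps a point in the target when its transverse coordinate is replaced by
  -- another in the ball, and makes the slice over `0` convex.
  let B := Metric.ball (Lc (H x₀)) δ ×ˢ Metric.ball (0 : Eu (n - d)) δ
  let Θ := (Θ₀.symm.restrOpen B (Metric.isOpen_ball.prod Metric.isOpen_ball)).symm
  have hsrc : Θ.source ⊆ Θ₀.source := by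
    intro x hx
    have h1 := Θ.map_source hx
    have h2 := Θ.left_inv hx
    rw [← h2]
    exact Θ₀.map_target h1.1
  refine ⟨Θ, Lc (H x₀), δ, hδ, ?_, fun x hx => (hsub (hsrc hx)).1, fun x => ?_, ?_, ?_, ?_, ?_⟩
  · have h1 : Θ₀ x₀ ∈ Θ.target := ⟨Θ₀.map_source hx₀, by
      rw [hΘx]; exact ⟨Metric.mem_ball_self hδ, Metric.mem_ball_self hδ⟩⟩
    have h2 := Θ.map_target h1
    rwa [show Θ.symm (Θ₀ x₀) = x₀ from Θ₀.left_inv hx₀] at h2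
  · exact congrArg Prod.snd (hΘ x)
  · refine (hc.mono (hsrc.trans hsub)).congr fun x _ => hΘ x
  · exact hΘs.mono fun z hz => hz.1
  · exact inter_eq_self_of_subset_right hball
  · intro x hx
    have hxS' := (hsub (hsrc hx)).2
    have h1 : (fun x => (Θ x).1) = fun x => Lc (H x) := funext fun x => congrArg Prod.fst (hΘ x)
    have h2 : HasFDerivAt H (fderiv ℝ H x) x :=
      ((hH.contDiffAt (hS.mem_nhds hxS')).differentiableAt (by simp)).hasFDerivAt
    have h3 : HasFDerivAt (fun x => Lc (H x)) (Lc.comp (fderiv ℝ H x)) x :=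
      Lc.hasFDerivAt.comp x h2
    rw [h1, h3.fderiv, ContinuousLinearMap.comp_apply, hHg x hxS']
    exact hLg

/-! ### From a transverse output to the zero dynamics and the normal form -/

theorem brunovskyA_mulVec_of_lt {r : ℕ} (v : Fin r → ℝ) (i : Fin r) (hi : (i : ℕ) + 1 < r) :
    (brunovskyA r).mulVec v i = v ⟨i + 1, hi⟩ := by
  rw [Matrix.mulVec, dotProduct, Finset.sum_eq_single ⟨i + 1, hi⟩]
  · simp [brunovskyA]
  · intro j _ hj
    have : (i : ℕ) + 1 ≠ j := fun h => hj (Fin.ext h.symm)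
    simp [brunovskyA, this]
  · simp

theorem brunovskyA_mulVec_of_eq {r : ℕ} (v : Fin r → ℝ) (i : Fin r) (hi : (i : ℕ) + 1 = r) :
    (brunovskyA r).mulVec v i = 0 := by
  rw [Matrix.mulVec, dotProduct]
  refine Finset.sum_eq_zero fun j _ => ?_
  have : (i : ℕ) + 1 ≠ j := by omega
  simp [brunovskyA, this]

/-- Coordinates adapted to a transverse output: `(c, λ, L_f λ, …, L_f^(r-1) λ)` with `L_g c = 0`,
in which `Γ` is the slice where the transverse coordinates vanish. -/
theorem IsObservableTransverseOutput.exists_coordinates {n p nstar : ℕ} (hlt : nstar < n)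
    {f g : Eu n → Eu n} (hf : ContDiff ℝ ∞ f) (hg : ContDiff ℝ ∞ g)
    {h : Eu n → Eu p} (hh : ContDiff ℝ ∞ h) {Γ : Set (Eu n)}
    (hsub : IsEmbeddedSubmanifold nstar Γ) (hinv : IsControlledInvariant f g Γ)
    {x₀ : Eu n} (hx₀ : x₀ ∈ Γ) {lam : Eu p → ℝ} {W : Set (Eu p)} {U : Set (Eu n)}
    (hobs : IsObservableTransverseOutput nstar f g h Γ x₀ lam W U) :
    ∃ (Θ : OpenPartialHomeomorph (Eu n) (Eu nstar × Eu (n - nstar))) (y₀ : Eu nstar) (δ : ℝ),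
      0 < δ ∧ x₀ ∈ Θ.source ∧ Θ.source ⊆ U ∧ (∀ x, (Θ x).2 = lieChain f (lam ∘ h) (n - nstar) x) ∧
      ContDiffOn ℝ ∞ Θ Θ.source ∧ ContDiffOn ℝ ∞ Θ.symm Θ.target ∧
      Θ.target = Metric.ball y₀ δ ×ˢ Metric.ball 0 δ ∧
      (∀ x ∈ Θ.source, fderiv ℝ (fun x => (Θ x).1) x (g x) = 0) ∧
      (∀ x ∈ Θ.source, x ∈ Γ ↔ lieChain f (lam ∘ h) (n - nstar) x = 0) ∧
      (∀ k, k + 1 < n - nstar → ∀ x ∈ Θ.source, lieD g ((lieD f)^[k] (lam ∘ h)) x = 0) ∧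
      (∀ x ∈ Θ.source, lieD g ((lieD f)^[n - nstar - 1] (lam ∘ h)) x ≠ 0) ∧
      ContDiffOn ℝ ∞ (lam ∘ h) Θ.source := by
  obtain ⟨⟨hW, hxW, hlam⟩, ⟨hU, hxU, hmaps, hΓU⟩, hr1, hr2, hr3⟩ := hobs
  have hμ : ContDiffOn ℝ ∞ (lam ∘ h) U := hlam.comp hh.contDiffOn hmaps
  have hev : ∀ᶠ x in 𝓝 x₀, ∀ k, k + 1 < n - nstar → lieD g ((lieD f)^[k] (lam ∘ h)) x = 0 := by
    have h1 : ∀ᶠ x in 𝓝 x₀, ∀ k ∈ Finset.range (n - nstar - 1),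
        lieD g ((lieD f)^[k] (lam ∘ h)) x = 0 :=
      (eventually_all_finset _).2 fun k hk => hr2 k (by have := Finset.mem_range.1 hk; omega)
    filter_upwards [h1] with x hx k hk
    exact hx k (Finset.mem_range.2 (by omega))
  have hne : ∀ᶠ x in 𝓝 x₀, lieD g ((lieD f)^[n - nstar - 1] (lam ∘ h)) x ≠ 0 :=
    ((((hμ.iterate_lieD hf hU _).lieD hg hU).continuousOn).continuousAt
      (hU.mem_nhds hxU)).eventually_ne hr3
  obtain ⟨V, hVs, hV, hxV⟩ := eventually_nhds_iff.1 ((hev.and hne).and (hU.mem_nhds hxU))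
  have hVU : V ⊆ U := fun x hx => (hVs x hx).2
  have h0 : ∀ k, k + 1 < n - nstar → ∀ x ∈ V, lieD g ((lieD f)^[k] (lam ∘ h)) x = 0 :=
    fun k hk x hx => (hVs x hx).1.1 k hk
  have hμV := hμ.mono hVU
  have hξV : ContDiffOn ℝ ∞ (lieChain f (lam ∘ h) (n - nstar)) V := hμV.lieChain hf hV
  have hzero : ∀ x ∈ Γ ∩ V, lieChain f (lam ∘ h) (n - nstar) x = 0 := fun x hx =>
    lieChain_eq_zero_iff.2 fun k hk => hinv.iterate_lieD_eq_zero hf hμV hV h0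
      (fun y hy => (hΓU ⟨hy.1, hVU hy.2⟩).2) k hk x hx
  have hsurj := surjective_fderiv_lieChain hf hg hμV hV h0 hxV hr3
  have hiff := hsub.eventually_mem_iff hx₀ hV hxV hξV hzero hsurj
  obtain ⟨V', hVs', hV', hxV'⟩ := eventually_nhds_iff.1 (hiff.and (hV.mem_nhds hxV))
  have hVV' : V' ⊆ V := fun x hx => (hVs' x hx).2
  have hgξ : fderiv ℝ (lieChain f (lam ∘ h) (n - nstar)) x₀ (g x₀) ≠ 0 := by
    intro h1
    have h2 := congrArg (fun v : Eu (n - nstar) => v ⟨n - nstar - 1, by omega⟩) h1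
    simp only at h2
    rw [fderiv_euclidean_apply
      ((hξV.contDiffAt (hV.mem_nhds hxV)).differentiableAt (by simp))] at h2
    exact hr3 h2
  obtain ⟨Θ, y₀, δ, hδ, hxΘ, hΘV, hΘ2, hΘ, hΘs, htar, hΘg⟩ := exists_adapted_coordinates hlt.le hg
    hV' hxV' (hξV.mono hVV') hsurj hgξ (hzero _ ⟨hx₀, hxV⟩)
  exact ⟨Θ, y₀, δ, hδ, hxΘ, fun x hx => hVU (hVV' (hΘV hx)), hΘ2, hΘ, hΘs, htar, hΘg,
    fun x hx => (hVs' x (hΘV hx)).1, fun k hk x hx => h0 k hk x (hVV' (hΘV hx)),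
    fun x hx => (hVs x (hVV' (hΘV hx))).1.2, hμ.mono fun x hx => hVU (hVV' (hΘV hx))⟩

/-- Near `x₀`, the target set is a connected component of the zero dynamics manifold. -/
theorem IsObservableTransverseOutput.exists_component {n p nstar : ℕ} (hlt : nstar < n)
    {f g : Eu n → Eu n} (hf : ContDiff ℝ ∞ f) (hg : ContDiff ℝ ∞ g)
    {h : Eu n → Eu p} (hh : ContDiff ℝ ∞ h) {Γ : Set (Eu n)}
    (hsub : IsEmbeddedSubmanifold nstar Γ) (hinv : IsControlledInvariant f g Γ)
    {x₀ : Eu n} (hx₀ : x₀ ∈ Γ) {lam : Eu p → ℝ} {W : Set (Eu p)} {U : Set (Eu n)}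
    (hobs : IsObservableTransverseOutput nstar f g h Γ x₀ lam W U) :
    ∃ V : Set (Eu n), IsOpen V ∧ x₀ ∈ V ∧ V ⊆ U ∧
      ∃ z ∈ zeroDynamicsManifold f (lam ∘ h) (n - nstar) U,
        connectedComponentIn (zeroDynamicsManifold f (lam ∘ h) (n - nstar) U) z ∩ V =
          Γ ∩ V := by
  obtain ⟨Θ, y₀, δ, hδ, hxΘ, hΘU, hΘ2, hΘ, hΘs, htar, -, hΘΓ, -⟩ :=
    hobs.exists_coordinates hlt hf hg hh hsub hinv hx₀
  have hmem : ∀ x ∈ Θ.source, (x ∈ Γ ↔ x ∈ zeroDynamicsManifold f (lam ∘ h) (n - nstar) U) :=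
    fun x hx => (hΘΓ x hx).trans
      (lieChain_eq_zero_iff.trans ⟨fun H => ⟨hΘU hx, H⟩, fun H => H.2⟩)
  refine ⟨Θ.source, Θ.open_source, hxΘ, hΘU, x₀, (hmem x₀ hxΘ).1 hx₀, ?_⟩
  refine Subset.antisymm (fun x hx => ⟨(hmem x hx.2).2 (connectedComponentIn_subset _ _ hx.1), hx.2⟩)
    fun x hx => ⟨?_, hx.2⟩
  -- The image of the convex slice is connected, lies in the zero dynamics manifold, and contains
  -- all of `Γ` in the chart.
  let C : Set (Eu n) := Θ.symm '' (Metric.ball y₀ δ ×ˢ {(0 : Eu (n - nstar))})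
  have hslice : Metric.ball y₀ δ ×ˢ {(0 : Eu (n - nstar))} ⊆ Θ.target := by
    rw [htar]
    exact prod_mono_right (singleton_subset_iff.2 (Metric.mem_ball_self hδ))
  have hC : IsPreconnected C :=
    (((convex_ball y₀ δ).isPreconnected).prod isPreconnected_singleton).image _
      (Θ.symm.continuousOn.mono hslice)
  have hΓC : ∀ y ∈ Γ ∩ Θ.source, y ∈ C := by
    intro y hy
    have h1 := Θ.map_source hy.2
    rw [htar] at h1
    refine ⟨Θ y, ⟨h1.1, ?_⟩, Θ.left_inv hy.2⟩
    rw [mem_singleton_iff, hΘ2]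
    exact (hΘΓ y hy.2).1 hy.1
  refine hC.subset_connectedComponentIn (hΓC x₀ ⟨hx₀, hxΘ⟩) ?_ (hΓC x hx)
  rintro _ ⟨z, hz, rfl⟩
  have hzs := Θ.map_target (hslice hz)
  refine (hmem _ hzs).1 ((hΘΓ _ hzs).2 ?_)
  rw [← hΘ2, Θ.right_inv (hslice hz)]
  exact hz.2

/-- A transverse output which is a function of the measured output solves LTFLPI. -/
theorem IsObservableTransverseOutput.ltflpiSolvable {n p nstar : ℕ} (hlt : nstar < n)
    {f g : Eu n → Eu n} (hf : ContDiff ℝ ∞ f) (hg : ContDiff ℝ ∞ g)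
    {h : Eu n → Eu p} (hh : ContDiff ℝ ∞ h) {Γ : Set (Eu n)}
    (hsub : IsEmbeddedSubmanifold nstar Γ) (hinv : IsControlledInvariant f g Γ)
    {x₀ : Eu n} (hx₀ : x₀ ∈ Γ) {lam : Eu p → ℝ} {W : Set (Eu p)} {U : Set (Eu n)}
    (hobs : IsObservableTransverseOutput nstar f g h Γ x₀ lam W U) :
    LTFLPISolvable nstar hlt f g h Γ x₀ := by
  obtain ⟨Θ, y₀, δ, hδ, hxΘ, -, hΘ2, hΘ, hΘs, htar, hΘg, hΘΓ, h0, hne, hμ⟩ :=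
    hobs.exists_coordinates hlt hf hg hh hsub hinv hx₀
  let r := n - nstar
  let ξ : Eu n → Eu r := lieChain f (lam ∘ h) r
  let S := Θ.source
  have hS : IsOpen S := Θ.open_source
  have hξ : ContDiffOn ℝ ∞ ξ S := hμ.lieChain hf hS
  -- `η` retracts the chart domain onto `Γ` by setting the transverse coordinates to zero; `Ψ`
  -- undoes this by restoring them.
  let η : Eu n → Eu n := fun x => Θ.symm ((Θ x).1, 0)
  let Ξ : Eu n → Eu n × Eu r := fun x => (η x, ξ x)
  let Ψ : Eu n × Eu r → Eu n := fun z => Θ.symm ((Θ z.1).1, z.2)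
  have hc : ∀ x ∈ S, (Θ x).1 ∈ Metric.ball y₀ δ ∧ ξ x ∈ Metric.ball 0 δ := by
    intro x hx
    have h1 := Θ.map_source hx
    rw [htar] at h1
    refine ⟨h1.1, ?_⟩
    change lieChain f (lam ∘ h) (n - nstar) x ∈ _
    rw [← hΘ2 x]
    exact h1.2
  have htmem : ∀ x ∈ S, ∀ w ∈ Metric.ball (0 : Eu r) δ, ((Θ x).1, w) ∈ Θ.target := by
    intro x hx w hw
    rw [htar]
    exact ⟨(hc x hx).1, hw⟩
  have h0b : (0 : Eu r) ∈ Metric.ball (0 : Eu r) δ := Metric.mem_ball_self hδ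
  have hηΓ : ∀ x ∈ S, η x ∈ Γ ∩ S := by
    intro x hx
    have ht := htmem x hx 0 h0b
    have hs := Θ.map_target ht
    refine ⟨(hΘΓ _ hs).2 ?_, hs⟩
    rw [← hΘ2, Θ.right_inv ht]
  have hη1 : ∀ x ∈ S, (Θ (η x)).1 = (Θ x).1 := by
    intro x hx
    simp only [η]
    rw [Θ.right_inv (htmem x hx 0 h0b)]
  have hηfix : ∀ x ∈ Γ ∩ S, η x = x := by
    intro x hx
    have h1 : ((Θ x).1, (0 : Eu r)) = Θ x :=
      Prod.ext rfl (by rw [hΘ2]; exact ((hΘΓ x hx.2).1 hx.1).symm)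
    simp only [η]
    rw [h1, Θ.left_inv hx.2]
  have himg : Ξ '' S = (univ ×ˢ Metric.ball 0 δ) ∩ (Γ ∩ S) ×ˢ univ := by
    ext ⟨q, w⟩
    constructor
    · rintro ⟨x, hx, hxe⟩
      rw [← hxe]
      exact ⟨⟨mem_univ _, (hc x hx).2⟩, hηΓ x hx, mem_univ _⟩
    · rintro ⟨⟨-, hw⟩, hq, -⟩
      have ht := htmem q hq.2 w hw
      have hx : Θ.symm ((Θ q).1, w) ∈ S := Θ.map_target ht
      refine ⟨Θ.symm ((Θ q).1, w), hx, Prod.ext ?_ ?_⟩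
      · refine Eq.trans ?_ (hηfix q hq)
        simp only [Ξ, η]
        rw [Θ.right_inv ht]
      · simp only [Ξ, ξ]
        rw [← hΘ2, Θ.right_inv ht]
  have himg' : ∀ z ∈ Ξ '' S, z.1 ∈ S ∧ z.2 ∈ Metric.ball 0 δ := by
    intro z hz
    rw [himg] at hz
    exact ⟨hz.2.1.2, hz.1.2⟩
  have hΨΞ : ∀ x ∈ S, Ψ (Ξ x) = x := by
    intro x hx
    simp only [Ψ, Ξ]
    rw [hη1 x hx, show ((Θ x).1, ξ x) = Θ x from Prod.ext rfl (hΘ2 x).symm, Θ.left_inv hx]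
  have hΨ : ContDiffOn ℝ ∞ Ψ (Ξ '' S) := by
    refine hΘs.comp ((contDiff_fst.comp_contDiffOn
      (hΘ.comp contDiff_fst.contDiffOn fun z hz => (himg' z hz).1)).prodMk
        contDiff_snd.contDiffOn) fun z hz => ?_
    exact htmem _ (himg' z hz).1 _ (himg' z hz).2
  have hΨS : MapsTo Ψ (Ξ '' S) S := by
    rintro _ ⟨x, hx, rfl⟩
    rwa [hΨΞ x hx]
  have hc1 : ContDiffOn ℝ ∞ (fun x => (Θ x).1) S := contDiff_fst.comp_contDiffOn hΘ
  have hη : ContDiffOn ℝ ∞ η S :=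
    hΘs.comp (hc1.prodMk contDiffOn_const) fun x hx => htmem x hx 0 h0b
  -- `η` depends on `x` only through the first integrals of `g`, so the input drops out of the `η`
  -- dynamics.
  have hηg : ∀ x ∈ S, fderiv ℝ η x (g x) = 0 := by
    intro x hx
    have h1 : HasFDerivAt (fun x => ((Θ x).1, (0 : Eu r)))
        ((fderiv ℝ (fun x => (Θ x).1) x).prod (0 : Eu n →L[ℝ] Eu r)) x :=
      ((hc1.contDiffAt (hS.mem_nhds hx)).differentiableAt (by simp)).hasFDerivAt.prodMk
        (hasFDerivAt_const _ _)
    have h2 : HasFDerivAt Θ.symm (fderiv ℝ Θ.symm ((Θ x).1, 0)) ((Θ x).1, 0) :=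
      ((hΘs.contDiffAt (Θ.open_target.mem_nhds (htmem x hx 0 h0b))).differentiableAt
        (by simp)).hasFDerivAt
    have h3 : HasFDerivAt η _ x := HasFDerivAt.comp (g := Θ.symm) x h2 h1
    rw [h3.fderiv, ContinuousLinearMap.comp_apply, ContinuousLinearMap.prod_apply, hΘg x hx]
    exact map_zero _
  refine ⟨S, Ξ, hS, hxΘ, ⟨hηΓ, ⟨univ ×ˢ Metric.ball 0 δ, isOpen_univ.prod Metric.isOpen_ball, himg⟩,
    hη.prodMk hξ, Ψ, hΨ, hΨΞ⟩, fun x hx => (hΘΓ x hx.2).1 hx.1,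
    ⟨fun z => fderiv ℝ η (Ψ z) (f (Ψ z)), fun z => lieD f ((lieD f)^[r - 1] (lam ∘ h)) (Ψ z),
      fun z => lieD g ((lieD f)^[r - 1] (lam ∘ h)) (Ψ z), ?_, ?_, ?_, ?_, ?_⟩, lam, fun x _ => rfl⟩
  · exact ((hη.fderiv_of_isOpen hS (by simp)).clm_apply hf.contDiffOn).comp hΨ hΨS
  · exact ((hμ.iterate_lieD hf hS _).lieD hf hS).comp hΨ hΨS
  · exact ((hμ.iterate_lieD hf hS _).lieD hg hS).comp hΨ hΨS
  · exact fun z hz => hne _ (hΨS hz)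
  · intro x hx u
    have hηd := (hη.contDiffAt (hS.mem_nhds hx)).differentiableAt (by simp)
    have hξd := (hξ.contDiffAt (hS.mem_nhds hx)).differentiableAt (by simp)
    rw [show fderiv ℝ Ξ x = (fderiv ℝ η x).prod (fderiv ℝ ξ x) from
      (hηd.hasFDerivAt.prodMk hξd.hasFDerivAt).fderiv, ContinuousLinearMap.prod_apply]
    simp only [hΨΞ x hx]
    refine Prod.ext ?_ ?_
    · simp only [map_add, map_smul, hηg x hx, smul_zero, add_zero]
    · ext i
      have hi := i.2
      have h1 : fderiv ℝ ξ x (f x + u • g x) i = lieD f ((lieD f)^[i] (lam ∘ h)) x +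
          u * lieD g ((lieD f)^[i] (lam ∘ h)) x := by
        rw [fderiv_euclidean_apply hξd, map_add, map_smul]
        rfl
      rw [h1]
      simp only [Pi.add_apply, Pi.smul_apply, smul_eq_mul]
      rcases Nat.lt_or_eq_of_le (Nat.succ_le_of_lt hi) with hlt' | heq
      · rw [brunovskyA_mulVec_of_lt _ i hlt', h0 i hlt' x hx,
          ← Function.iterate_succ_apply' (lieD f)]
        have : (i : ℕ) + 1 ≠ n - nstar := hlt'.ne
        simp [brunovskyB, this, Ξ, ξ, lieChain, r]
      · rw [brunovskyA_mulVec_of_eq _ i heq]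
        have h2 : (i : ℕ) = r - 1 := by change (i : ℕ) = n - nstar - 1; omega
        have h3 : (i : ℕ) + 1 = n - nstar := heq
        rw [h2]
        simp only [brunovskyB, h3, if_true]
        ring

/-! ### From the normal form to a transverse output -/

/-- A smooth map with surjective derivative at `x` has a smooth local section through `x`. -/
theorem ContDiff.exists_local_section {n p : ℕ} {h : Eu n → Eu p} (hh : ContDiff ℝ ∞ h) {x : Eu n}
    (hsurj : Function.Surjective (fderiv ℝ h x)) :
    ∃ σ : Eu p → Eu n, ContDiffAt ℝ ∞ σ (h x) ∧ σ (h x) = x ∧ ∀ᶠ y in 𝓝 (h x), h (σ y) = y := by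
  obtain ⟨R, hR⟩ := LinearMap.exists_rightInverse_of_surjective
    (fderiv ℝ h x : Eu n →ₗ[ℝ] Eu p) (LinearMap.range_eq_top.2 hsurj)
  let Rc : Eu p →L[ℝ] Eu n := LinearMap.toContinuousLinearMap R
  let s : Eu p → Eu n := fun y => x + Rc y
  have hs : ContDiff ℝ ∞ s := contDiff_const.add Rc.contDiff
  have hs0 : s 0 = x := by simp [s]
  have hd : HasFDerivAt (fun y => h (s y)) ((ContinuousLinearEquiv.refl ℝ (Eu p) :
      Eu p ≃L[ℝ] Eu p) : Eu p →L[ℝ] Eu p) 0 := by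
    have h1 : HasFDerivAt h (fderiv ℝ h x) (s 0) := by
      rw [hs0]; exact (hh.differentiable (by simp) x).hasFDerivAt
    refine (h1.comp 0 (Rc.hasFDerivAt.const_add x)).congr_fderiv ?_
    exact ContinuousLinearMap.ext fun y => LinearMap.congr_fun hR y
  obtain ⟨Φ, h0, -, hΦ, hΦs⟩ := (hh.comp hs).contDiffOn.exists_smooth_openPartialHomeomorph
    isOpen_univ (mem_univ (0 : Eu p)) hd
  have hΦ0 : Φ 0 = h x := by rw [hΦ, Function.comp_apply, hs0]
  have ht : Φ.target ∈ 𝓝 (h x) := Φ.open_target.mem_nhds (hΦ0 ▸ Φ.map_source h0)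
  refine ⟨fun y => s (Φ.symm y), hs.contDiffAt.comp _ (hΦs.contDiffAt ht), ?_, ?_⟩
  · change s (Φ.symm (h x)) = x
    rw [← hΦ0, Φ.left_inv h0, hs0]
  · filter_upwards [ht] with y hy
    exact (hΦ _).symm.trans (Φ.right_inv hy)

/-- A solution of LTFLPI provides a transverse output which is a function of the measured output. -/
theorem LTFLPISolvable.exists_output {n p nstar : ℕ} {hlt : nstar < n}
    {f g : Eu n → Eu n} {h : Eu n → Eu p} (hh : ContDiff ℝ ∞ h)
    (hrank : ∀ x, Function.Surjective (fderiv ℝ h x)) {Γ : Set (Eu n)} {x₀ : Eu n}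
    (hsol : LTFLPISolvable nstar hlt f g h Γ x₀) :
    ∃ (lam : Eu p → ℝ) (W : Set (Eu p)) (U : Set (Eu n)),
      IsObservableTransverseOutput nstar f g h Γ x₀ lam W U := by
  obtain ⟨U, Ξ, hU, hxU, ⟨-, -, hΞ, -⟩, hi, ⟨f₀, a₁, a₂, -, -, -, ha₂, hdyn⟩, lam, hlam⟩ := hsol
  have hcomp : ∀ i, ContDiffOn ℝ ∞ (fun x => (Ξ x).2 i) U :=
    fun i => contDiffOn_euclidean.1 (contDiff_snd.comp_contDiffOn hΞ) i
  -- Along a local section `σ` of `h`, `lam` equals `ξ₁ ∘ σ`, which is smooth; the section also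
  -- shows that `h '' U` is a neighbourhood of `h x`.
  have hsec : ∀ x ∈ U, (∀ᶠ y in 𝓝 (h x), y ∈ h '' U) ∧ ContDiffAt ℝ ∞ lam (h x) := by
    intro x hx
    obtain ⟨σ, hσ, hσx, hσh⟩ := hh.exists_local_section (hrank x)
    have hσU : ∀ᶠ y in 𝓝 (h x), σ y ∈ U :=
      hσ.continuousAt.eventually (hU.mem_nhds (hσx.symm ▸ hx))
    refine ⟨?_, ?_⟩
    · filter_upwards [hσh, hσU] with y h1 h2 using ⟨σ y, h2, h1⟩
    · have h1 : ContDiffAt ℝ ∞ (fun y => (Ξ (σ y)).2 ⟨0, Nat.sub_pos_of_lt hlt⟩) (h x) :=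
        ContDiffAt.comp (g := fun x => (Ξ x).2 ⟨0, Nat.sub_pos_of_lt hlt⟩) (h x)
          ((hcomp _).contDiffAt (hU.mem_nhds (hσx.symm ▸ hx))) hσ
      refine h1.congr_of_eventuallyEq ?_
      filter_upwards [hσh, hσU] with y h2 h3
      rw [hlam _ h3, h2]
  have hder : ∀ x ∈ U, ∀ (i : Fin (n - nstar)) (u : ℝ),
      fderiv ℝ (fun x => (Ξ x).2 i) x (f x + u • g x) =
        (brunovskyA (n - nstar)).mulVec (Ξ x).2.ofLp i +
          (a₁ (Ξ x) + a₂ (Ξ x) * u) * brunovskyB (n - nstar) i := by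
    intro x hx i u
    have hd := (hΞ.contDiffAt (hU.mem_nhds hx)).differentiableAt (by simp)
    have h1 : HasFDerivAt (fun x => (Ξ x).2)
        ((ContinuousLinearMap.snd ℝ _ _).comp (fderiv ℝ Ξ x)) x :=
      hd.hasFDerivAt.snd
    rw [← fderiv_euclidean_apply h1.differentiableAt, h1.fderiv, ContinuousLinearMap.comp_apply,
      hdyn x hx u]
    rfl
  -- The dynamics hold for every input: `u = 0` isolates the drift, and subtracting it from `u = 1`
  -- isolates the input field.
  have hdf : ∀ x ∈ U, ∀ i : Fin (n - nstar), fderiv ℝ (fun x => (Ξ x).2 i) x (f x) =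
      (brunovskyA (n - nstar)).mulVec (Ξ x).2.ofLp i + a₁ (Ξ x) * brunovskyB (n - nstar) i := by
    intro x hx i
    simpa using hder x hx i 0
  have hdg : ∀ x ∈ U, ∀ i : Fin (n - nstar), fderiv ℝ (fun x => (Ξ x).2 i) x (g x) =
      a₂ (Ξ x) * brunovskyB (n - nstar) i := by
    intro x hx i
    have h1 := hder x hx i 1
    rw [map_add, hdf x hx i, one_smul] at h1
    linarith
  have hchain : ∀ k (hk : k < n - nstar), ∀ x ∈ U,
      (lieD f)^[k] (lam ∘ h) x = (Ξ x).2 ⟨k, hk⟩ := by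
    intro k
    induction k with
    | zero => exact fun _ x hx => (hlam x hx).symm
    | succ k ih =>
      intro hk x hx
      have hev : (lieD f)^[k] (lam ∘ h) =ᶠ[𝓝 x] fun x => (Ξ x).2 ⟨k, by omega⟩ := by
        filter_upwards [hU.mem_nhds hx] with y hy using ih (by omega) y hy
      rw [Function.iterate_succ_apply', lieD, hev.fderiv_eq, hdf x hx,
        brunovskyA_mulVec_of_lt _ ⟨k, by omega⟩ hk]
      have : k + 1 ≠ n - nstar := hk.ne
      simp [brunovskyB, this]
  have hlg : ∀ k (hk : k < n - nstar), ∀ x ∈ U,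
      lieD g ((lieD f)^[k] (lam ∘ h)) x = a₂ (Ξ x) * brunovskyB (n - nstar) ⟨k, hk⟩ := by
    intro k hk x hx
    have hev : (lieD f)^[k] (lam ∘ h) =ᶠ[𝓝 x] fun x => (Ξ x).2 ⟨k, hk⟩ := by
      filter_upwards [hU.mem_nhds hx] with y hy using hchain k hk y hy
    rw [lieD, hev.fderiv_eq, hdg x hx]
  refine ⟨lam, h '' U, U, ⟨?_, mem_image_of_mem h hxU, ?_⟩,
    ⟨hU, hxU, mapsTo_image h U, fun x hx => ⟨hx.2, ?_⟩⟩, by omega, fun k hk => ?_, ?_⟩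
  · refine isOpen_iff_mem_nhds.2 ?_
    rintro _ ⟨x, hx, rfl⟩
    exact (hsec x hx).1
  · rintro _ ⟨x, hx, rfl⟩
    exact (hsec x hx).2.contDiffWithinAt
  · rw [← hlam x hx.2, hi x hx]
    rfl
  · filter_upwards [hU.mem_nhds hxU] with x hx
    have : k + 1 ≠ n - nstar := hk.ne
    rw [hlg k (by omega) x hx]
    simp [brunovskyB, this]
  · have h1 : n - nstar - 1 + 1 = n - nstar := by omega
    rw [hlg (n - nstar - 1) (by omega) x₀ hxU]
    simpa [brunovskyB, h1] using ha₂ _ (mem_image_of_mem Ξ hxU)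

theorem mainTheorem2 {n p nstar : ℕ} (hpos : 0 < nstar) (hlt : nstar < n)
    (f g : Eu n → Eu n) (hf : ContDiff ℝ ∞ f) (hg : ContDiff ℝ ∞ g)
    (h : Eu n → Eu p) (hh : ContDiff ℝ ∞ h)
    (hrank : ∀ x, Function.Surjective (fderiv ℝ h x))
    (Γ : Set (Eu n)) (hclosed : IsClosed Γ) (hconn : IsConnected Γ)
    (hsub : IsEmbeddedSubmanifold nstar Γ) (hinv : IsControlledInvariant f g Γ)
    (x₀ : Eu n) (hx₀ : x₀ ∈ Γ) :
    (LTFLPISolvable nstar hlt f g h Γ x₀ ↔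
      ∃ (lam : Eu p → ℝ) (W : Set (Eu p)) (U : Set (Eu n)),
        IsObservableTransverseOutput nstar f g h Γ x₀ lam W U) ∧
    ∀ (lam : Eu p → ℝ) (W : Set (Eu p)) (U : Set (Eu n)),
      IsObservableTransverseOutput nstar f g h Γ x₀ lam W U →
        ∃ V : Set (Eu n), IsOpen V ∧ x₀ ∈ V ∧ V ⊆ U ∧
          ∃ z ∈ zeroDynamicsManifold f (lam ∘ h) (n - nstar) U,
            connectedComponentIn (zeroDynamicsManifold f (lam ∘ h) (n - nstar) U) z ∩ V =
              Γ ∩ V := by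
  exact ⟨⟨fun hsol => hsol.exists_output hh hrank,
      fun ⟨_, _, _, hobs⟩ => hobs.ltflpiSolvable hlt hf hg hh hsub hinv hx₀⟩,
    fun _ _ _ hobs => hobs.exists_component hlt hf hg hh hsub hinv hx₀⟩
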